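/- **Definitions.** Let $T$ be a connected metric space. $T$ is a *lifted space* if there are a homeomorphism $h$ of $\mathbb R$ onto a subspace of $T$ and a homeomorphism $\tau:T\to T$ such that (i) $\tau(h(x))=h(x+1)$ for all $x\in\mathbb R$; (ii) the closure of each connected component of $T\setminus h(\mathbb R)$ is compact and meets $h(\mathbb R)$ in exactly one point; (iii) only finitely many connected components $C$ of $T\setminus h(\mathbb R)$ satisfy $\overline C\cap h([0,1])\ne\emptyset$; and (iv) for every compact $K\subset T$ there are only finitely many $n\in\mathbb Z$ with $\tau^n(K)\cap K\neq\emptyset$. Identify $h(\mathbb R)$ with $\mathbb R$ and write $x+n$ for $\tau^n(x)$ ($n\in\mathbb Z$), and $A+\mathbb Z=\bigcup_{n\in\mathbb Z}\tau^n(A)$ for $A\subset T$. The retraction $r:T\to\mathbb R$ is the identity on $\mathbb R$ and maps a point of a component $C$ of $T\setminus\mathbb R$ to the unique point of $\overline C\cap\mathbb R$. A *finite graph* is a compact connected space $G$ with a finite subset $V$ such that $G\setminus V$ has finitely many connected components, each homeomorphic to an open interval. A lifted space $T$ is an *infinite graph* if $r^{-1}([0,1])$ is a finite graph. A map $F:T\to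 T$ has *degree one* if it is continuous and $F(x+1)=F(x)+1$ for all $x\in T$. It is *transitive mod 1* if for all nonempty open $U,V\subset T$ there is $n\ge0$ with $(F^n(U)+\mathbb Z)\cap V\neq\emptyset$. For $x\in T$ let $$\underline\rho_F(x)=\liminf_{n\to\infty}\frac{r(F^n(x))-r(x)}n,\qquad \overline\rho_F(x)=\limsup_{n\to\infty}\frac{r(F^n(x))-r(x)}n,$$ and, when they are equal, call their common value the rotation number $\rho_F(x)$. Let $\mathrm{Rot}^+(F)=\{\overline\rho_F(x):x\in T\}$, $\mathrm{Rot}^-(F)=\{\underline\rho_F(x):x\in T\}$, $\mathrm{Rot}(F)=\{\rho_F(x):x\in T,\ \rho_F(x)\text{ exists}\}$ and $\mathrm{Rot}_{\mathbb R}(F)=\{\rho_F(x):x\in\mathbb R,\ \rho_F(x)\text{ exists}\}$. **Theorem.** Let $T$ be an infinite graph and let $F:T\to T$ be a map of degree one. If the closure of $\bigcup_{n\ge0}F^n(\mathbb R)$ is all of $T$, then $$\mathrm{Rot}_{\mathbb R}(F)=\mathrm{Rot}(F)=\mathrm{Rot}^+(F)=\mathrm{Rot}^-(F).$$ Moreover,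 if $F$ is transitive mod 1, then the closure of $\bigcup_{n\ge0}F^n(\mathbb R)$ is all of $T$. -/

import Mathlib

open Set Filter Topology

/-- `C` is a connected component of the subset `S` of `T`. -/
def IsComponentOf {T : Type*} [TopologicalSpace T] (S C : Set T) : Prop :=
  ∃ x ∈ S, C = connectedComponentIn S x

/-- A (topological) finite graph inside `T`: a compact connected set with a finite subset `V` such
that its complement in the set has finitely many connected components, each of them homeomorphic
to an open interval. -/
def IsFiniteGraph {T : Type*} [TopologicalSpace T] (S : Set T) : Prop :=
  IsCompact S ∧ IsConnected S ∧
    ∃ V : Set T, V ⊆ S ∧ V.Finite ∧ {C | IsComponentOf (S \ V) C}.Finite ∧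
      ∀ C, IsComponentOf (S \ V) C → Nonempty (C ≃ₜ Ioo (0 : ℝ) 1)

/-- The structure of a lifted space on a (connected) metric space `T`: a copy `h` of the real line
in `T` and a translation `τ` of `T`. -/
structure LiftedSpace (T : Type*) [MetricSpace T] where
  /-- the copy of the real line -/
  h : ℝ → T
  /-- the translation `x ↦ x + 1` -/
  τ : T ≃ₜ T
  isEmbedding_h : IsEmbedding h
  τ_h : ∀ x : ℝ, τ (h x) = h (x + 1)
  isCompact_closure : ∀ C, IsComponentOf (range h)ᶜ C → IsCompact (closure C)
  closure_inter : ∀ C, IsComponentOf (range h)ᶜ C → ∃ z, closure C ∩ range h = {z}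
  finite_components :
    {C | IsComponentOf (range h)ᶜ C ∧ (closure C ∩ h '' Icc 0 1).Nonempty}.Finite
  /-- the translations act properly: a compact set meets only finitely many of its translates -/
  finite_translates : ∀ K : Set T, IsCompact K → {n : ℤ | ((τ ^ n) '' K ∩ K).Nonempty}.Finite

namespace LiftedSpace

variable {T : Type*} [MetricSpace T] (L : LiftedSpace T)

/-- The copy of the real line in `T`. -/
def line : Set T := range L.h

/-- `h t` is the point of the line to which `x` is retracted: `x` itself if `x` is on the line,
and otherwise the point of the line in the closure of the component of `x` off the line. -/
def IsFoot (x : T) (t : ℝ) : Prop :=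
  (x ∈ L.line ∧ L.h t = x) ∨
    (x ∉ L.line ∧ L.h t ∈ closure (connectedComponentIn L.lineᶜ x))

theorem existsUnique_isFoot (x : T) : ∃! t, L.IsFoot x t := by
  by_cases hx : x ∈ L.line
  · obtain ⟨t, rfl⟩ := hx
    refine ⟨t, Or.inl ⟨⟨t, rfl⟩, rfl⟩, ?_⟩
    rintro s (⟨-, hs⟩ | ⟨hs, -⟩)
    · exact L.isEmbedding_h.injective hs
    · exact absurd ⟨t, rfl⟩ hs
  · obtain ⟨z, hz⟩ := L.closure_inter _ ⟨x, hx, rfl⟩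
    have hz' : z ∈ closure (connectedComponentIn (range L.h)ᶜ x) ∩ range L.h := by
      rw [hz]; rfl
    obtain ⟨h1, t, rfl⟩ := hz'
    refine ⟨t, Or.inr ⟨hx, h1⟩, ?_⟩
    rintro s (⟨hs, -⟩ | ⟨-, hs⟩)
    · exact absurd hs hx
    · have : L.h s ∈ closure (connectedComponentIn (range L.h)ᶜ x) ∩ range L.h :=
        ⟨hs, s, rfl⟩
      rw [hz] at this
      exact L.isEmbedding_h.injective this

/-- The natural retraction of `T` onto the line, with values read as real numbers through `h`. -/
noncomputable def r (x : T) : ℝ := (L.existsUnique_isFoot x).choose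

/-- `T` is an infinite graph: `r⁻¹([0,1])` is a finite graph. -/
def IsInfiniteGraph : Prop := IsFiniteGraph (L.r ⁻¹' Icc 0 1)

/-- Continuous self-maps of `T` of degree one: `F (x + 1) = F x + 1`. -/
def IsDegreeOne (F : T → T) : Prop :=
  Continuous F ∧ ∀ x, F (L.τ x) = L.τ (F x)

/-- Transitivity mod 1: for all nonempty open `U`, `V` there is `n ≥ 0` such that
`(F^n(U) + ℤ) ∩ V` is nonempty. -/
def IsTransitiveModOne (F : T → T) : Prop :=
  ∀ U V : Set T, IsOpen U → U.Nonempty → IsOpen V → V.Nonempty →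
    ∃ n : ℕ, ((⋃ m : ℤ, (L.τ ^ m) '' (F^[n] '' U)) ∩ V).Nonempty

/-- The lower rotation number of `x`. For a map of degree one of an infinite graph the quotients
are bounded, so the real `liminf` (and `limsup` below) is the genuine one. -/
noncomputable def lowerRot (F : T → T) (x : T) : ℝ :=
  liminf (fun n : ℕ => (L.r (F^[n] x) - L.r x) / n) atTop

/-- The upper rotation number of `x`. -/
noncomputable def upperRot (F : T → T) (x : T) : ℝ :=
  limsup (fun n : ℕ => (L.r (F^[n] x) - L.r x) / n) atTop

/-- `Rot⁺(F)`: the upper rotation numbers of all points. -/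
def RotPlus (F : T → T) : Set ℝ := {ρ | ∃ x, L.upperRot F x = ρ}

/-- `Rot⁻(F)`: the lower rotation numbers of all points. -/
def RotMinus (F : T → T) : Set ℝ := {ρ | ∃ x, L.lowerRot F x = ρ}

/-- `Rot(F)`: the rotation numbers of all points that have one. -/
def Rot (F : T → T) : Set ℝ := {ρ | ∃ x, L.lowerRot F x = ρ ∧ L.upperRot F x = ρ}

/-- `Rot_ℝ(F)`: the rotation numbers of all points of the line that have one. -/
def RotLine (F : T → T) : Set ℝ :=
  {ρ | ∃ x ∈ L.line, L.lowerRot F x = ρ ∧ L.upperRot F x = ρ}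

end LiftedSpace

/-! Write `X_m` for `F^m(ℝ)`. Every point `h t` cuts `T`, so a connected set with points on both
sides of `t` contains `h t`. Hence the images `X_m` increase, and the image under `F^n` of a unit
interval of the line covers another one, displaced by `r (F^n w) - w` up to error 2, whatever `w` on
the line. Chaining such coverings and intersecting nested compact sets gives a point of the line
with a prescribed itinerary; `exists_rotation` thus realises each limit point of averages along an
orbit starting on the line as a genuine rotation number on the line.

It remains to shadow an arbitrary orbit, up to bounded error, by one starting on the line
(`exists_line_shadow`). If the orbit enters some `X_m`, shifting times suffices. Otherwise it stays
in the residue. Density of `⋃ X_m` leaves at most one residue point in an open arc, so the residue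
is finite modulo translation (`finite_residue_unit`) and the orbit is eventually periodic mod 1.
Replacing `F` by a translated iterate makes the periodic point a fixed point `z`. Points near `z`
that are reached late from the line have backward orbits staying near `z`
(`exists_backward_stable`); a limit of their starting points on the line shadows `z`. -/

theorem closure_connectedComponentIn_inter_subset {X : Type*} [TopologicalSpace X] (S : Set X)
    (x : X) : closure (connectedComponentIn S x) ∩ S ⊆ connectedComponentIn S x := by
  rintro y ⟨hy, hyS⟩
  by_cases hx : x ∈ S
  · have h1 : IsPreconnected (insert y (connectedComponentIn S x)) :=
      isPreconnected_connectedComponentIn.subset_closure (subset_insert _ _)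
        (insert_subset hy subset_closure)
    exact h1.subset_connectedComponentIn (mem_insert_of_mem _ (mem_connectedComponentIn hx))
      (insert_subset hyS (connectedComponentIn_subset S x)) (mem_insert _ _)
  · simp [connectedComponentIn_eq_empty hx] at hy

/-! ### The retraction and the separation of `T` by points of the line -/

namespace LiftedSpace

variable {T : Type*} [MetricSpace T] (L : LiftedSpace T)

theorem isFoot_r (x : T) : L.IsFoot x (L.r x) := (L.existsUnique_isFoot x).choose_spec.1

variable {L} in
theorem IsFoot.r_eq {x : T} {t : ℝ} (ht : L.IsFoot x t) : L.r x = t :=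
  (L.existsUnique_isFoot x).unique (L.isFoot_r x) ht

@[simp]
theorem r_h (t : ℝ) : L.r (L.h t) = t := IsFoot.r_eq (Or.inl ⟨⟨t, rfl⟩, rfl⟩)

theorem h_mem_line (t : ℝ) : L.h t ∈ L.line := ⟨t, rfl⟩

theorem h_r_of_mem_line {x : T} (hx : x ∈ L.line) : L.h (L.r x) = x := by
  obtain ⟨t, rfl⟩ := hx
  rw [r_h]

theorem h_r_mem_closure {x : T} (hx : x ∉ L.line) :
    L.h (L.r x) ∈ closure (connectedComponentIn L.lineᶜ x) := by
  rcases L.isFoot_r x with h | h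
  · exact absurd h.1 hx
  · exact h.2

theorem r_eq_of_mem_connectedComponentIn {x y : T} (hx : x ∉ L.line)
    (hy : y ∈ connectedComponentIn L.lineᶜ x) : L.r y = L.r x := by
  have hy' : y ∈ L.lineᶜ := connectedComponentIn_subset _ _ hy
  refine IsFoot.r_eq (Or.inr ⟨hy', ?_⟩)
  rw [← connectedComponentIn_eq hy]
  exact L.h_r_mem_closure hx

theorem r_eq_of_mem_closure {x y : T} (hx : x ∉ L.line)
    (hy : y ∈ closure (connectedComponentIn L.lineᶜ x)) : L.r y = L.r x := by
  by_cases hyl : y ∈ L.line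
  · have h1 : L.IsFoot x (L.r y) := Or.inr ⟨hx, by rwa [L.h_r_of_mem_line hyl]⟩
    exact h1.r_eq.symm
  · exact L.r_eq_of_mem_connectedComponentIn hx
      (closure_connectedComponentIn_inter_subset _ _ ⟨hy, hyl⟩)

theorem τ_image_line : L.τ '' L.line = L.line := by
  ext x
  constructor
  · rintro ⟨_, ⟨t, rfl⟩, rfl⟩
    exact ⟨t + 1, (L.τ_h t).symm⟩
  · rintro ⟨t, rfl⟩
    exact ⟨L.h (t - 1), ⟨_, rfl⟩, by rw [L.τ_h]; simp⟩

theorem τ_mem_line {x : T} : L.τ x ∈ L.line ↔ x ∈ L.line := by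
  nth_rw 1 [← L.τ_image_line]
  exact L.τ.injective.mem_set_image

theorem r_τ (x : T) : L.r (L.τ x) = L.r x + 1 := by
  apply IsFoot.r_eq
  by_cases hx : x ∈ L.line
  · refine Or.inl ⟨L.τ_mem_line.2 hx, ?_⟩
    rw [← L.τ_h, L.h_r_of_mem_line hx]
  · refine Or.inr ⟨fun h => hx (L.τ_mem_line.1 h), ?_⟩
    have h1 := L.τ.image_connectedComponentIn (s := L.lineᶜ) (x := x) hx
    rw [image_compl_eq L.τ.bijective, L.τ_image_line] at h1
    rw [← h1, ← L.τ.image_closure, ← L.τ_h]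
    exact mem_image_of_mem _ (L.h_r_mem_closure hx)

theorem r_τ_zpow (n : ℤ) (x : T) : L.r ((L.τ ^ n) x) = L.r x + n := by
  induction n generalizing x with
  | zero => simp
  | succ n ih =>
    rw [zpow_add_one, Homeomorph.mul_apply, ih, r_τ]; push_cast; ring
  | pred n ih =>
    have h1 := L.r_τ (L.τ⁻¹ x)
    have h2 : L.τ (L.τ⁻¹ x) = x := by
      rw [← Homeomorph.mul_apply, mul_inv_cancel]; rfl
    rw [h2] at h1
    rw [zpow_sub_one, Homeomorph.mul_apply, ih]; push_cast; linarith

theorem τ_zpow_mem_line (n : ℤ) {x : T} (hx : x ∈ L.line) : (L.τ ^ n) x ∈ L.line := by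
  induction n generalizing x with
  | zero => simpa
  | succ n ih =>
    rw [zpow_add_one, Homeomorph.mul_apply]
    exact ih (L.τ_mem_line.2 hx)
  | pred n ih =>
    rw [zpow_sub_one, Homeomorph.mul_apply]
    apply ih
    rw [← L.τ_mem_line, ← Homeomorph.mul_apply, mul_inv_cancel]
    exact hx

theorem τ_zpow_h (n : ℤ) (t : ℝ) : (L.τ ^ n) (L.h t) = L.h (t + n) := by
  rw [← L.h_r_of_mem_line (L.τ_zpow_mem_line n (L.h_mem_line t)), r_τ_zpow, r_h]

theorem τ_zpow_cancel (n : ℤ) (x : T) : (L.τ ^ n) ((L.τ ^ (-n)) x) = x := by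
  rw [← Homeomorph.mul_apply, ← zpow_add]; simp

theorem τ_zpow_cancel' (n : ℤ) (x : T) : (L.τ ^ (-n)) ((L.τ ^ n) x) = x := by
  rw [← Homeomorph.mul_apply, ← zpow_add]; simp

/-- The positions on the line at which components off the line are attached. -/
def feet : Set ℝ := L.r '' L.lineᶜ

theorem finite_feet_inter_unit : (L.feet ∩ Icc 0 1).Finite := by
  refine (L.finite_components.biUnion (t := fun C => {t | L.h t ∈ closure C ∩ range L.h})
    fun C hC => ?_).subset ?_
  · obtain ⟨z, hz⟩ := L.closure_inter C hC.1
    rw [hz]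
    exact (finite_singleton z).preimage L.isEmbedding_h.injective.injOn
  · rintro _ ⟨⟨x, hx, rfl⟩, ht⟩
    have := L.h_r_mem_closure hx
    exact mem_biUnion (x := connectedComponentIn L.lineᶜ x)
      ⟨⟨x, hx, rfl⟩, _, this, _, ht, rfl⟩ ⟨this, _, rfl⟩

theorem finite_feet_inter (n : ℤ) : (L.feet ∩ Icc (n : ℝ) (n + 1)).Finite := by
  refine (L.finite_feet_inter_unit.image (· + (n : ℝ))).subset ?_
  rintro _ ⟨⟨x, hx, rfl⟩, h1, h2⟩
  refine ⟨L.r x - n, ⟨⟨(L.τ ^ (-n)) x, fun h => hx ?_, ?_⟩, ?_, ?_⟩, by simp⟩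
  · have := L.τ_zpow_mem_line n h
    rwa [τ_zpow_cancel] at this
  · rw [r_τ_zpow]; push_cast; ring
  · linarith
  · linarith

variable {L} in
theorem IsInfiniteGraph.isCompact_slab (hL : L.IsInfiniteGraph) (n : ℤ) :
    IsCompact (L.r ⁻¹' Icc (n : ℝ) (n + 1)) := by
  have h : L.r ⁻¹' Icc (n : ℝ) (n + 1) = (L.τ ^ n) '' (L.r ⁻¹' Icc 0 1) := by
    ext x
    constructor
    · rintro ⟨h1, h2⟩
      refine ⟨(L.τ ^ (-n)) x, ?_, L.τ_zpow_cancel n x⟩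
      simp only [mem_preimage, mem_Icc, r_τ_zpow]
      push_cast
      constructor <;> linarith
    · rintro ⟨y, ⟨h1, h2⟩, rfl⟩
      simp only [mem_preimage, mem_Icc, r_τ_zpow]
      constructor <;> linarith
  rw [h]
  exact hL.1.image (L.τ ^ n).continuous

variable {L} in
-- Otherwise points of slabs with unbounded index converge to `x`. The sequence, its limit and the
-- slab over `[0,1]` form a compact set meeting infinitely many of its translates, against
-- properness.
theorem IsInfiniteGraph.locallyFinite_slab (hL : L.IsInfiniteGraph) :
    LocallyFinite fun n : ℤ => L.r ⁻¹' Icc (n : ℝ) (n + 1) := by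
  intro x
  by_contra! hx
  have h1 : ∀ k : ℕ, ∃ n : ℤ, ∃ y : T, dist y x < 1 / (k + 1) ∧
      y ∈ L.r ⁻¹' Icc (n : ℝ) (n + 1) ∧ (k : ℤ) < |n| := by
    intro k
    have h2 := hx (Metric.ball x (1 / (k + 1))) (Metric.ball_mem_nhds x (by positivity))
    obtain ⟨n, hn, hnk⟩ := Set.Infinite.exists_notMem_finite h2 (finite_Icc (-(k : ℤ)) k)
    obtain ⟨y, hy1, hy2⟩ := hn
    refine ⟨n, y, hy2, hy1, ?_⟩
    by_contra h
    exact hnk (abs_le.1 (not_lt.1 h))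
  choose n y hy1 hy2 hn using h1
  have hlim : Tendsto y atTop (𝓝 x) := by
    rw [tendsto_iff_dist_tendsto_zero]
    exact squeeze_zero (fun _ => dist_nonneg) (fun k => (hy1 k).le)
      tendsto_one_div_add_atTop_nhds_zero_nat
  have hK := hlim.isCompact_insert_range.union (hL.isCompact_slab 0)
  have hfin := L.finite_translates _ hK
  have hmem : ∀ k, n k ∈ {n : ℤ | ((L.τ ^ n) '' (insert x (range y) ∪
      L.r ⁻¹' Icc ((0 : ℤ) : ℝ) ((0 : ℤ) + 1)) ∩ (insert x (range y) ∪
      L.r ⁻¹' Icc ((0 : ℤ) : ℝ) ((0 : ℤ) + 1))).Nonempty} := by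
    intro k
    refine ⟨y k, ⟨(L.τ ^ (-n k)) (y k), Or.inr ?_, L.τ_zpow_cancel _ _⟩,
      Or.inl (mem_insert_of_mem _ ⟨k, rfl⟩)⟩
    obtain ⟨h1, h2⟩ := hy2 k
    simp only [mem_preimage, mem_Icc, r_τ_zpow]
    push_cast
    constructor <;> linarith
  obtain ⟨M, hM⟩ := (hfin.image fun n : ℤ => |n|).bddAbove
  have h3 := hM ⟨_, hmem M.toNat, rfl⟩
  have h4 := hn M.toNat
  have h5 := Int.self_le_toNat M
  simp only at h3
  omega

variable {L} in
-- Over `[0,1]`, `r` inverts `h` on the segment and is constant on the closures of finitely many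
-- components. These closed pieces glue, and so do the translated slabs by local finiteness.
theorem IsInfiniteGraph.continuous_r (hL : L.IsInfiniteGraph) : Continuous L.r := by
  have h0 : ContinuousOn L.r (L.h '' Icc 0 1) := by
    refine ContinuousOn.mono ?_ (image_subset_range L.h (Icc 0 1))
    rw [continuousOn_iff_continuous_domRestrict]
    refine L.isEmbedding_h.toHomeomorph.symm.continuous.congr fun x => ?_
    obtain ⟨_, t, rfl⟩ := x
    simp only [domRestrict_apply, r_h]
    rw [Homeomorph.symm_apply_eq]
    rfl
  have h1 : ContinuousOn L.r (L.r ⁻¹' Icc 0 1) := by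
    set 𝒞 := {C | IsComponentOf (range L.h)ᶜ C ∧ (closure C ∩ L.h '' Icc 0 1).Nonempty}
    have hfin : Finite 𝒞 := L.finite_components
    have h2 : ContinuousOn L.r (⋃ C : 𝒞, closure C.1) := by
      refine (locallyFinite_of_finite _).continuousOn_iUnion (fun _ => isClosed_closure) ?_
      rintro ⟨_, ⟨x, hx, rfl⟩, -⟩
      exact (continuousOn_const (c := L.r x)).congr fun y hy => L.r_eq_of_mem_closure hx hy
    refine (h0.union_of_isClosed h2 (isCompact_Icc.image L.isEmbedding_h.continuous).isClosed
      (isClosed_iUnion_of_finite fun _ => isClosed_closure)).mono fun x hx => ?_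
    by_cases hxl : x ∈ L.line
    · exact Or.inl ⟨_, hx, L.h_r_of_mem_line hxl⟩
    · exact Or.inr (mem_iUnion.2 ⟨⟨_, ⟨x, hxl, rfl⟩, _, L.h_r_mem_closure hxl, _, hx, rfl⟩,
        subset_closure (mem_connectedComponentIn hxl)⟩)
  refine hL.locallyFinite_slab.continuous ?_ (fun n => (hL.isCompact_slab n).isClosed) fun n => ?_
  · exact eq_univ_of_forall fun x => mem_iUnion.2
      ⟨⌊L.r x⌋, Int.floor_le _, (Int.lt_floor_add_one _).le⟩
  · have h3 : ContinuousOn (fun x => L.r ((L.τ ^ (-n)) x)) (L.r ⁻¹' Icc (n : ℝ) (n + 1)) := by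
      refine h1.comp (L.τ ^ (-n)).continuous.continuousOn fun x hx => ?_
      obtain ⟨h1, h2⟩ := hx
      simp only [mem_preimage, mem_Icc, r_τ_zpow]
      push_cast
      constructor <;> linarith
    refine (h3.add (continuousOn_const (c := (n : ℝ)))).congr fun x _ => ?_
    change L.r x = L.r ((L.τ ^ (-n)) x) + n
    rw [r_τ_zpow]; push_cast; ring

variable {L} in
theorem IsInfiniteGraph.isCompact_preimage_Icc (hL : L.IsInfiniteGraph) (a b : ℝ) :
    IsCompact (L.r ⁻¹' Icc a b) := by
  refine ((finite_Icc ⌊a⌋ ⌊b⌋).isCompact_biUnion fun n _ => hL.isCompact_slab n).of_isClosed_subset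
    (isClosed_Icc.preimage hL.continuous_r) fun x hx => ?_
  exact mem_biUnion (x := ⌊L.r x⌋) ⟨Int.floor_mono hx.1, Int.floor_mono hx.2⟩
    ⟨Int.floor_le _, (Int.lt_floor_add_one _).le⟩

variable {L} in
theorem IsInfiniteGraph.isClosed_line (hL : L.IsInfiniteGraph) : IsClosed L.line := by
  have : L.line = {x | L.h (L.r x) = x} := by
    ext x
    exact ⟨fun hx => L.h_r_of_mem_line hx, fun hx => ⟨_, hx⟩⟩
  rw [this]
  exact isClosed_eq (L.isEmbedding_h.continuous.comp hL.continuous_r) continuous_id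

theorem isClosed_of_subset_feet {s : Set ℝ} (hs : s ⊆ L.feet) : IsClosed s := by
  have h1 : LocallyFinite fun n : ℤ => Icc (n : ℝ) (n + 1) := by
    intro x
    refine ⟨Ioo (x - 1) (x + 1), Ioo_mem_nhds (by linarith) (by linarith),
      (finite_Icc (⌊x⌋ - 2) (⌊x⌋ + 2)).subset ?_⟩
    rintro n ⟨y, ⟨h1, h2⟩, h3, h4⟩
    have h5 := Int.floor_le x
    have h6 := Int.lt_floor_add_one x
    constructor
    · have : (⌊x⌋ : ℝ) < n + 2 := by linarith
      have : ⌊x⌋ < n + 2 := by exact_mod_cast this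
      omega
    · have : (n : ℝ) < ⌊x⌋ + 2 := by linarith
      have : n < ⌊x⌋ + 2 := by exact_mod_cast this
      omega
  have h2 : s = ⋃ n : ℤ, s ∩ Icc (n : ℝ) (n + 1) := by
    rw [← inter_iUnion]
    refine (inter_eq_left.2 fun x _ => mem_iUnion.2 ?_).symm
    exact ⟨⌊x⌋, Int.floor_le _, (Int.lt_floor_add_one _).le⟩
  rw [h2]
  exact (h1.subset fun n => inter_subset_right).isClosed_iUnion fun n =>
    ((L.finite_feet_inter n).subset (inter_subset_inter_left _ hs)).isClosed

variable {L} in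
-- Off the line, `r` is continuous with values in the discrete set of feet.
theorem IsInfiniteGraph.eventually_r_eq (hL : L.IsInfiniteGraph) {x : T} (hx : x ∉ L.line) :
    ∀ᶠ y in 𝓝 x, L.r y = L.r x := by
  have h1 : IsClosed (L.feet \ {L.r x}) := L.isClosed_of_subset_feet sdiff_subset
  filter_upwards [hL.isClosed_line.isOpen_compl.mem_nhds hx,
    (h1.isOpen_compl.preimage hL.continuous_r).mem_nhds (x := x) (by simp)] with y hy1 hy2
  by_contra h
  exact hy2 ⟨⟨y, hy1, rfl⟩, h⟩

variable {L} in
-- The other points of the fibre over `t` lie off the line, where `r` is locally constant. For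
-- closed half-lines ending at `t` this says that `h t` separates `T`.
theorem IsInfiniteGraph.isOpen_preimage_diff (hL : L.IsInfiniteGraph) {t : ℝ} {s : Set ℝ}
    (hs : IsOpen (s \ {t})) : IsOpen (L.r ⁻¹' s \ {L.h t}) := by
  rw [isOpen_iff_mem_nhds]
  rintro x ⟨hx, hxt⟩
  refine inter_mem ?_ (isOpen_compl_singleton.mem_nhds hxt)
  by_cases hr : L.r x = t
  · have : x ∉ L.line := fun h => hxt (by rw [← hr, L.h_r_of_mem_line h]; rfl)
    filter_upwards [hL.eventually_r_eq this] with y hy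
    rw [mem_preimage, hy]; exact hx
  · exact hL.continuous_r.continuousAt
      (mem_of_superset (hs.mem_nhds ⟨hx, hr⟩) sdiff_subset)

variable {L} in
/-- A connected set with points on both sides of `t` contains the point `t` of the line. -/
theorem IsInfiniteGraph.h_mem_of_isPreconnected (hL : L.IsInfiniteGraph) {Z : Set T}
    (hZ : IsPreconnected Z) {a b : T} (ha : a ∈ Z) (hb : b ∈ Z) {t : ℝ} (hat : L.r a ≤ t)
    (htb : t ≤ L.r b) (hab : L.r a < L.r b) : L.h t ∈ Z := by
  by_contra hn
  have hne : ∀ x ∈ Z, x ∉ ({L.h t} : Set T) := by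
    rintro x hx rfl
    exact hn hx
  rcases hat.lt_or_eq with hlt | heq
  · obtain ⟨x, -, h1, h2⟩ := hZ (L.r ⁻¹' Iio t) (L.r ⁻¹' Ici t \ {L.h t})
      (isOpen_Iio.preimage hL.continuous_r)
      (hL.isOpen_preimage_diff (by rw [Ici_sdiff_left]; exact isOpen_Ioi))
      (fun x hx => (lt_or_ge (L.r x) t).imp id fun h => ⟨h, hne x hx⟩)
      ⟨a, ha, hlt⟩ ⟨b, hb, htb, hne b hb⟩
    exact (show t ≤ L.r x from h2.1).not_gt h1
  · obtain ⟨x, -, h1, h2⟩ := hZ (L.r ⁻¹' Iic t \ {L.h t}) (L.r ⁻¹' Ioi t)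
      (hL.isOpen_preimage_diff (by rw [Iic_sdiff_right]; exact isOpen_Iio))
      (isOpen_Ioi.preimage hL.continuous_r)
      (fun x hx => (le_or_gt (L.r x) t).imp (fun h => ⟨h, hne x hx⟩) id)
      ⟨a, ha, hat, hne a ha⟩ ⟨b, hb, by rw [← heq]; exact hab⟩
    exact (show L.r x ≤ t from h1.1).not_gt h2

end LiftedSpace

/-! ### Displacements, coverings and rotation numbers of points of the line -/

namespace LiftedSpace

variable {T : Type*} [MetricSpace T] {L : LiftedSpace T} {F : T → T}

theorem IsDegreeOne.iterate (hF : L.IsDegreeOne F) (n : ℕ) : L.IsDegreeOne F^[n] := by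
  refine ⟨hF.1.iterate n, fun x => ?_⟩
  have h : Function.Commute F L.τ := hF.2
  exact h.iterate_left n x

theorem IsDegreeOne.apply_τ_zpow (hF : L.IsDegreeOne F) (n : ℤ) (x : T) :
    F ((L.τ ^ n) x) = (L.τ ^ n) (F x) := by
  have h1 : ∀ x, F (L.τ⁻¹ x) = L.τ⁻¹ (F x) := by
    intro x
    apply L.τ.injective
    rw [← hF.2, ← Homeomorph.mul_apply, ← Homeomorph.mul_apply, mul_inv_cancel]
    rfl
  induction n generalizing x with
  | zero => simp
  | succ n ih => rw [zpow_add_one, Homeomorph.mul_apply, ih, hF.2, Homeomorph.mul_apply]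
  | pred n ih => rw [zpow_sub_one, Homeomorph.mul_apply, ih, h1, Homeomorph.mul_apply]

theorem IsDegreeOne.r_apply_h_add (hF : L.IsDegreeOne F) (t : ℝ) (n : ℤ) :
    L.r (F (L.h (t + n))) = L.r (F (L.h t)) + n := by
  rw [← τ_zpow_h, hF.apply_τ_zpow, r_τ_zpow]

theorem IsInfiniteGraph.exists_displacement_bound (hL : L.IsInfiniteGraph)
    (hF : L.IsDegreeOne F) : ∃ C, 0 ≤ C ∧ ∀ x, |L.r (F x) - L.r x| ≤ C := by
  have hcont : Continuous fun x => L.r (F x) - L.r x :=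
    (hL.continuous_r.comp hF.1).sub hL.continuous_r
  obtain ⟨C, hC⟩ := (hL.isCompact_preimage_Icc 0 1).exists_bound_of_continuousOn hcont.continuousOn
  have key : ∀ x, |L.r (F x) - L.r x| ≤ C := by
    intro x
    have h1 := hC ((L.τ ^ (-⌊L.r x⌋)) x) (by
      simp only [mem_preimage, mem_Icc, r_τ_zpow]
      push_cast
      have := Int.floor_le (L.r x)
      have := Int.lt_floor_add_one (L.r x)
      constructor <;> linarith)
    rw [hF.apply_τ_zpow, r_τ_zpow, r_τ_zpow, Real.norm_eq_abs] at h1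
    convert h1 using 2
    ring
  exact ⟨C, (abs_nonneg _).trans (key (L.h 0)), key⟩

theorem abs_r_iterate_sub_le {C : ℝ} (hC : ∀ x, |L.r (F x) - L.r x| ≤ C) (n : ℕ) (x : T) :
    |L.r (F^[n] x) - L.r x| ≤ n * C := by
  induction n with
  | zero => simp
  | succ n ih =>
    rw [Function.iterate_succ_apply']
    have := abs_sub_le (L.r (F (F^[n] x))) (L.r (F^[n] x)) (L.r x)
    have := hC (F^[n] x)
    push_cast
    linarith

/-- The image of a unit interval of the line covers a unit interval of the line, displaced
approximately by the displacement of any given point of the line. -/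
theorem IsInfiniteGraph.exists_unit_covering (hL : L.IsInfiniteGraph) (hF : L.IsDegreeOne F)
    (y w : ℝ) : ∃ y', |y' - y - (L.r (F (L.h w)) - w)| ≤ 2 ∧
      ∀ t ∈ Icc y' (y' + 1), ∃ s ∈ Icc y (y + 1), F (L.h s) = L.h t := by
  set g : ℝ → ℝ := fun s => L.r (F (L.h s)) with hg
  obtain ⟨k, hk⟩ : ∃ k : ℤ, w + k ∈ Icc y (y + 1) := by
    refine ⟨⌈y - w⌉, ?_, ?_⟩
    · linarith [Int.le_ceil (y - w)]
    · linarith [Int.ceil_lt_add_one (y - w)]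
  have hgk : g (w + k) = g w + k := hF.r_apply_h_add w k
  have hg1 : g (y + 1) = g y + 1 := by simpa using hF.r_apply_h_add y 1
  have cover : ∀ a ∈ Icc y (y + 1), ∀ b ∈ Icc y (y + 1), ∀ t, g a < g b → g a ≤ t → t ≤ g b →
      ∃ s ∈ Icc y (y + 1), F (L.h s) = L.h t := by
    intro a ha b hb t hab hat htb
    have hZ : IsPreconnected ((fun s => F (L.h s)) '' Icc y (y + 1)) :=
      isPreconnected_Icc.image _ (hF.1.comp L.isEmbedding_h.continuous).continuousOn
    exact hL.h_mem_of_isPreconnected hZ (mem_image_of_mem _ ha) (mem_image_of_mem _ hb) hat htb hab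
  have hy0 : y ∈ Icc y (y + 1) := ⟨le_rfl, by linarith⟩
  have hy1 : y + 1 ∈ Icc y (y + 1) := ⟨by linarith, le_rfl⟩
  obtain ⟨hk1, hk2⟩ := hk
  change ∃ y', |y' - y - (g w - w)| ≤ 2 ∧ _
  -- Since `g (y + 1) = g y + 1`, two of the values at `y`, `w + k`, `y + 1` always bound an
  -- interval of length at least 1. The chosen `y'` is within 1 of `g (w + k)`, and `y` is within 1
  -- of `w + k`, whence the bound 2.
  rcases le_or_gt (g (w + k)) (g y) with h1 | h1
  · refine ⟨g (w + k), by rw [abs_le]; constructor <;> linarith, fun t ht => ?_⟩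
    exact cover (w + k) ⟨hk1, hk2⟩ (y + 1) hy1 t (by linarith) ht.1 (by linarith [ht.2])
  rcases le_or_gt (g (y + 1)) (g (w + k)) with h2 | h2
  · refine ⟨g (w + k) - 1, by rw [abs_le]; constructor <;> linarith, fun t ht => ?_⟩
    exact cover y hy0 (w + k) ⟨hk1, hk2⟩ t (by linarith) (by linarith [ht.1]) (by linarith [ht.2])
  · refine ⟨g y, by rw [abs_le]; constructor <;> linarith, fun t ht => ?_⟩
    exact cover y hy0 (y + 1) hy1 t (by linarith) ht.1 (by linarith [ht.2])

/-- Finite itineraries exist by pulling back through the coverings from the last interval; their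
starting points form nested compact sets. -/
theorem exists_itinerary (hF : Continuous F) (m : ℕ → ℕ) (y : ℕ → ℝ)
    (hy : ∀ j, ∀ t ∈ Icc (y (j + 1)) (y (j + 1) + 1), ∃ s ∈ Icc (y j) (y j + 1),
      F^[m j] (L.h s) = L.h t) :
    ∃ u, ∀ j, ∃ s ∈ Icc (y j) (y j + 1), F^[∑ i ∈ Finset.range j, m i] (L.h u) = L.h s := by
  let S : ℕ → Set ℝ := fun J => {u ∈ Icc (y 0) (y 0 + 1) | ∀ j ≤ J,
    F^[∑ i ∈ Finset.range j, m i] (L.h u) ∈ L.h '' Icc (y j) (y j + 1)}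
  have hfin : ∀ J, ∀ t ∈ Icc (y J) (y J + 1), ∃ u ∈ S J,
      F^[∑ i ∈ Finset.range J, m i] (L.h u) = L.h t := by
    intro J
    induction J with
    | zero =>
      intro t ht
      refine ⟨t, ⟨ht, fun j hj => ?_⟩, by simp⟩
      obtain rfl : j = 0 := by omega
      exact ⟨t, ht, by simp⟩
    | succ J ih =>
      intro t ht
      obtain ⟨s, hs, hst⟩ := hy J t ht
      obtain ⟨u, ⟨hu, huJ⟩, hus⟩ := ih s hs
      have h1 : F^[∑ i ∈ Finset.range (J + 1), m i] (L.h u) = L.h t := by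
        rw [Finset.sum_range_succ, add_comm, Function.iterate_add_apply, hus, hst]
      refine ⟨u, ⟨hu, fun j hj => ?_⟩, h1⟩
      rcases Nat.of_le_succ hj with h | rfl
      · exact huJ j h
      · exact ⟨t, ht, h1.symm⟩
  have hclosed : ∀ J, IsClosed (S J) := by
    intro J
    have : S J = Icc (y 0) (y 0 + 1) ∩ ⋂ j, ⋂ (_ : j ≤ J),
        (fun u => F^[∑ i ∈ Finset.range j, m i] (L.h u)) ⁻¹' (L.h '' Icc (y j) (y j + 1)) := by
      ext u; simp [S]
    rw [this]
    exact isClosed_Icc.inter (isClosed_iInter fun j => isClosed_iInter fun _ =>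
      (isCompact_Icc.image L.isEmbedding_h.continuous).isClosed.preimage
        ((hF.iterate _).comp L.isEmbedding_h.continuous))
  obtain ⟨u, hu⟩ := IsCompact.nonempty_iInter_of_sequence_nonempty_isCompact_isClosed S
    (fun J u hu => ⟨hu.1, fun j hj => hu.2 j (by omega)⟩)
    (fun J => by
      obtain ⟨u, hu, -⟩ := hfin J (y J) ⟨le_rfl, by linarith⟩
      exact ⟨u, hu⟩)
    (isCompact_Icc.of_isClosed_subset (hclosed 0) fun u hu => hu.1) hclosed
  refine ⟨u, fun j => ?_⟩
  obtain ⟨s, hs, h⟩ := (mem_iInter.1 hu j).2 j le_rfl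
  exact ⟨s, hs, h.symm⟩

/-- From arbitrarily large good lengths `p k` one can form a sequence of lengths, each of which is
good, that grows slowly. -/
theorem exists_slow_sequence (p : ℕ → ℕ) : ∃ κ : ℕ → ℕ, (∀ j, κ j * p (κ j) ≤ j) ∧
    Tendsto κ atTop atTop := by
  refine ⟨fun j => Nat.findGreatest (fun k => k * p k ≤ j) j, fun j => ?_, ?_⟩
  · exact Nat.findGreatest_spec (P := fun k => k * p k ≤ j) (Nat.zero_le j) (by simp)
  · refine tendsto_atTop.2 fun K => ?_
    filter_upwards [eventually_ge_atTop K, eventually_ge_atTop (K * p K)] with j h1 h2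
    exact Nat.le_findGreatest h1 h2

/-- Every limit point of the average displacements of a point of the line is the rotation number of
some point of the line. -/
theorem IsInfiniteGraph.exists_rotation (hL : L.IsInfiniteGraph) (hF : L.IsDegreeOne F) {w α : ℝ}
    (hw : ∀ ε > 0, ∀ N : ℕ, ∃ n ≥ N, |L.r (F^[n] (L.h w)) - w - n * α| ≤ ε * n) :
    ∃ u, ∀ ε > 0, ∃ C, ∀ n : ℕ, |L.r (F^[n] (L.h u)) - u - n * α| ≤ C + ε * n := by
  obtain ⟨C, hC0, hC⟩ := hL.exists_displacement_bound hF
  -- The lower bound on `p k` makes the covering error 2 at most `p k / (k + 1)`, the same as the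
  -- error of the average.
  choose p hp1 hp2 using fun k : ℕ => hw (1 / (k + 1)) (by positivity) (2 * (k + 1))
  obtain ⟨κ, hκ1, hκ2⟩ := exists_slow_sequence p
  choose nxt hn1 hn2 using fun (j : ℕ) (y : ℝ) =>
    hL.exists_unit_covering (hF.iterate (p (κ j))) y w
  let m : ℕ → ℕ := fun j => p (κ j)
  let y : ℕ → ℝ := fun j => Nat.rec 0 (fun j y => nxt j y) j
  have hy : ∀ j, y (j + 1) = nxt j (y j) := fun j => rfl
  let N : ℕ → ℕ := fun j => ∑ i ∈ Finset.range j, m i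
  have hN : ∀ j, N (j + 1) = N j + m j := fun j => Finset.sum_range_succ _ _
  have hN0 : N 0 = 0 := rfl
  obtain ⟨u, hu⟩ := exists_itinerary (L := L) hF.1 m y fun j => hn2 j (y j)
  have hm1 : ∀ j, 1 ≤ m j := fun j => by have := hp1 (κ j); simp only [m]; omega
  have hNj : ∀ j, j ≤ N j := by
    intro j
    induction j with
    | zero => simp
    | succ j ih => rw [hN]; have := hm1 j; omega
  have hNmono : Monotone N := monotone_nat_of_le_succ fun j => by rw [hN]; omega
  have herr : ∀ j, |y (j + 1) - y j - m j * α| ≤ 2 / (κ j + 1) * m j := by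
    intro j
    have h1 := hn1 j (y j)
    have h2 := hp2 (κ j)
    have h3 : (2 : ℝ) ≤ 1 / (κ j + 1) * m j := by
      rw [one_div, ← div_eq_inv_mul, le_div_iff₀ (by positivity)]
      exact_mod_cast hp1 (κ j)
    rw [hy]
    have h4 : nxt j (y j) - y j - m j * α = (nxt j (y j) - y j - (L.r (F^[p (κ j)] (L.h w)) - w)) +
      (L.r (F^[p (κ j)] (L.h w)) - w - m j * α) := by ring
    rw [h4]
    refine (abs_add_le _ _).trans ?_
    have h5 : 2 / ((κ j : ℝ) + 1) * m j = 1 / (κ j + 1) * m j + 1 / (κ j + 1) * m j := by ring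
    rw [h5]
    simp only [m] at h3 ⊢
    linarith
  refine ⟨u, fun ε hε => ?_⟩
  -- The endpoints of blocks contribute error rate `δ`; an unfinished block, of relative length
  -- about `δ`, costs at most `C + |α|` per unit of time.
  set δ := ε / (C + |α| + 1) with hδ
  have hδ0 : 0 < δ := by positivity
  obtain ⟨K, hK⟩ := exists_nat_ge (2 / δ)
  rw [div_le_iff₀ hδ0] at hK
  obtain ⟨J, hJ⟩ := (tendsto_atTop.1 hκ2 (K + 1)).exists_forall_of_atTop
  have hκδ : ∀ j, J ≤ j → 2 ≤ κ j * δ := fun j hj => by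
    have : ((K + 1 : ℕ) : ℝ) ≤ κ j := by exact_mod_cast hJ j hj
    push_cast at this
    nlinarith
  have herrδ : ∀ j, J ≤ j → |y (j + 1) - y j - m j * α| ≤ δ * m j := by
    intro j hj
    refine (herr j).trans ?_
    gcongr
    rw [div_le_iff₀ (by positivity)]
    nlinarith [hκδ j hj]
  -- Late blocks are short compared with the elapsed time, because `κ j * m j ≤ j ≤ N j`.
  have hmδ : ∀ j, (m j : ℝ) ≤ N J + δ * N j := by
    intro j
    rcases lt_or_ge j J with h | h
    · have h1 : (m j : ℝ) ≤ N J := by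
        have := hNmono (show j + 1 ≤ J from h)
        rw [hN] at this
        exact_mod_cast (show m j ≤ N J by omega)
      have : 0 ≤ δ * N j := by positivity
      linarith
    · have h1 : (κ j : ℝ) * m j ≤ N j := by exact_mod_cast (hκ1 j).trans (hNj j)
      have h2 := hκδ j h
      have h3 : (0 : ℝ) ≤ N J := by positivity
      have h4 : (0 : ℝ) ≤ m j := by positivity
      nlinarith
  have hyN : ∀ j, |y j - N j * α| ≤ 2 * N J + δ * N j := by
    -- Blocks before `J` get the crude error rate 2, later ones the rate `δ`.
    have h1 : ∀ j, |y j - N j * α| ≤ 2 * N (min j J) + δ * N j := by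
      intro j
      induction j with
      | zero => simp [y, hN0]
      | succ j ih =>
        have h2 : y (j + 1) - N (j + 1) * α = (y j - N j * α) + (y (j + 1) - y j - m j * α) := by
          rw [hN]; push_cast; ring
        rw [h2]
        refine (abs_add_le _ _).trans ?_
        have h0 : (0 : ℝ) ≤ m j := by positivity
        rcases lt_or_ge j J with h | h
        · rw [min_eq_left (by omega : j ≤ J)] at ih
          rw [min_eq_left (by omega : j + 1 ≤ J), hN]
          have h3 : (2 : ℝ) / (κ j + 1) * m j ≤ 2 * m j := by
            gcongr
            rw [div_le_iff₀ (by positivity)]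
            nlinarith [(Nat.cast_nonneg (κ j) : (0 : ℝ) ≤ κ j)]
          have h4 := herr j
          push_cast
          nlinarith
        · rw [min_eq_right h] at ih
          rw [min_eq_right (by omega : J ≤ j + 1), hN]
          have h4 := herrδ j h
          push_cast
          nlinarith
    intro j
    refine (h1 j).trans ?_
    have : (N (min j J) : ℝ) ≤ N J := by exact_mod_cast hNmono (min_le_right j J)
    linarith
  have hu0 : u ∈ Icc (0 : ℝ) (0 + 1) := by
    obtain ⟨s, hs, h⟩ := hu 0
    rw [Finset.sum_range_zero, Function.iterate_zero_apply] at h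
    rw [L.isEmbedding_h.injective h]
    exact hs
  refine ⟨(C + |α|) * N J + 2 + 2 * N J, fun n => ?_⟩
  obtain ⟨j, hj1, hj2⟩ : ∃ j, N j ≤ n ∧ n < N (j + 1) := by
    induction n with
    | zero => exact ⟨0, by simp [hN0], hNj 1⟩
    | succ n ih =>
      obtain ⟨j, h1, h2⟩ := ih
      rcases lt_or_ge (n + 1) (N (j + 1)) with h | h
      · exact ⟨j, by omega, h⟩
      · exact ⟨j + 1, h, by rw [hN]; have := hm1 (j + 1); omega⟩
  obtain ⟨i, rfl⟩ := Nat.exists_eq_add_of_le hj1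
  have him : (i : ℝ) ≤ m j := by
    rw [hN] at hj2
    exact_mod_cast (show i ≤ m j by omega)
  obtain ⟨s, hs, hus⟩ := hu j
  have h1 := abs_r_iterate_sub_le hC i (L.h s)
  rw [← hus, ← Function.iterate_add_apply, add_comm, hus, r_h] at h1
  change |L.r (F^[N j + i] (L.h u)) - s| ≤ i * C at h1
  have h2 := hyN j
  have h3 := hmδ j
  have hs' : |s - y j| ≤ 1 := by rw [abs_le]; constructor <;> linarith [hs.1, hs.2]
  have hu' : |u| ≤ 1 := by rw [abs_le]; constructor <;> linarith [hu0.1, hu0.2]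
  have h4 : L.r (F^[N j + i] (L.h u)) - u - ((N j + i : ℕ) : ℝ) * α =
      (L.r (F^[N j + i] (L.h u)) - s) + (s - y j) + (y j - N j * α) - u - i * α := by
    push_cast; ring
  have h5 : |(i : ℝ) * α| = i * |α| := by rw [abs_mul, abs_of_nonneg (by positivity)]
  have h6 : |L.r (F^[N j + i] (L.h u)) - u - ((N j + i : ℕ) : ℝ) * α| ≤
      i * C + 1 + (2 * N J + δ * N j) + 1 + i * |α| := by
    rw [h4]
    refine (abs_sub _ _).trans ?_
    refine add_le_add ((abs_sub _ _).trans ?_) h5.le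
    refine add_le_add ((abs_add_le _ _).trans (add_le_add ((abs_add_le _ _).trans ?_) h2)) hu'
    exact add_le_add h1 hs'
  have h7 : (i : ℝ) * (C + |α|) ≤ (N J + δ * N j) * (C + |α|) := by
    gcongr
    linarith
  have h8 : δ * (C + |α| + 1) = ε := by rw [hδ]; field_simp
  have h9 : ε * N j ≤ ε * ((N j + i : ℕ) : ℝ) := by
    gcongr
  rw [← h8] at h9 ⊢
  nlinarith

end LiftedSpace

/-! ### Images of the line and finiteness of the residue -/

namespace LiftedSpace

variable {T : Type*} [MetricSpace T] {L : LiftedSpace T} {F : T → T}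

theorem isPreconnected_line : IsPreconnected L.line :=
  isPreconnected_range L.isEmbedding_h.continuous

/-- The image is connected and, by degree one, unbounded in both directions. -/
theorem IsInfiniteGraph.line_subset_image_line (hL : L.IsInfiniteGraph) (hF : L.IsDegreeOne F) :
    L.line ⊆ F '' L.line := by
  rintro _ ⟨t, rfl⟩
  have hpos : ∀ n : ℤ, L.r (F (L.h n)) = L.r (F (L.h 0)) + n := fun n => by
    simpa using hF.r_apply_h_add 0 n
  have h1 := hpos (⌊t - L.r (F (L.h 0))⌋)
  have h2 := hpos (⌊t - L.r (F (L.h 0))⌋ + 1)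
  have h3 := Int.floor_le (t - L.r (F (L.h 0)))
  have h4 := Int.lt_floor_add_one (t - L.r (F (L.h 0)))
  push_cast at h2
  exact hL.h_mem_of_isPreconnected (isPreconnected_line.image F hF.1.continuousOn)
    (mem_image_of_mem F (L.h_mem_line _)) (mem_image_of_mem F (L.h_mem_line _))
    (h1.trans_le (by linarith)) (le_trans (by linarith) h2.ge) (by rw [h1, h2]; linarith)

theorem IsInfiniteGraph.monotone_image_line (hL : L.IsInfiniteGraph) (hF : L.IsDegreeOne F) :
    Monotone fun m : ℕ => F^[m] '' L.line := by
  refine monotone_nat_of_le_succ fun m => ?_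
  rw [Function.iterate_succ, image_comp]
  exact image_mono (hL.line_subset_image_line hF)

theorem IsInfiniteGraph.line_subset_iterate_image_line (hL : L.IsInfiniteGraph)
    (hF : L.IsDegreeOne F) (m : ℕ) : L.line ⊆ F^[m] '' L.line := by
  simpa using hL.monotone_image_line hF (Nat.zero_le m)

/-- Displacement is bounded, so near a given point only the image of a compact segment matters. -/
theorem IsInfiniteGraph.isClosed_image_line (hL : L.IsInfiniteGraph) (hF : L.IsDegreeOne F) :
    IsClosed (F '' L.line) := by
  obtain ⟨C, hC0, hC⟩ := hL.exists_displacement_bound hF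
  refine isClosed_of_closure_subset fun x hx => ?_
  have hK : IsCompact ((fun t => F (L.h t)) '' Icc (L.r x - 1 - C) (L.r x + 1 + C)) :=
    isCompact_Icc.image (hF.1.comp L.isEmbedding_h.continuous)
  have hU : L.r ⁻¹' Ioo (L.r x - 1) (L.r x + 1) ∈ 𝓝 x :=
    hL.continuous_r.continuousAt (Ioo_mem_nhds (by linarith) (by linarith))
  have h1 : x ∈ closure ((fun t => F (L.h t)) '' Icc (L.r x - 1 - C) (L.r x + 1 + C)) := by
    rw [mem_closure_iff_nhds] at hx ⊢
    intro U hxU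
    obtain ⟨_, ⟨hy1, hy2⟩, _, ⟨t, rfl⟩, rfl⟩ := hx _ (inter_mem hxU hU)
    have h2 := abs_le.1 (hC (L.h t))
    rw [r_h] at h2
    exact ⟨_, hy1, t, ⟨by linarith [hy2.1], by linarith [hy2.2]⟩, rfl⟩
  rw [hK.isClosed.closure_eq] at h1
  obtain ⟨t, -, rfl⟩ := h1
  exact mem_image_of_mem F (L.h_mem_line t)

theorem IsDegreeOne.τ_zpow_mem_image_line (hF : L.IsDegreeOne F) (n : ℤ) {x : T}
    (hx : x ∈ F '' L.line) : (L.τ ^ n) x ∈ F '' L.line := by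
  obtain ⟨y, hy, rfl⟩ := hx
  exact ⟨(L.τ ^ n) y, L.τ_zpow_mem_line n hy, hF.apply_τ_zpow n y⟩

variable (L F) in
/-- The points of `T` which are interior to none of the images `F^m(ℝ)`. -/
def residue : Set T := ⋂ m : ℕ, closure (F^[m] '' L.line)ᶜ

theorem IsDegreeOne.τ_zpow_mem_residue (hF : L.IsDegreeOne F) (n : ℤ) {x : T}
    (hx : x ∈ L.residue F) : (L.τ ^ n) x ∈ L.residue F := by
  refine mem_iInter.2 fun m => ?_
  have h1 : MapsTo (L.τ ^ n) (F^[m] '' L.line)ᶜ (F^[m] '' L.line)ᶜ := by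
    intro y hy h
    apply hy
    rw [← L.τ_zpow_cancel' n y]
    exact (hF.iterate m).τ_zpow_mem_image_line _ h
  exact h1.closure (L.τ ^ n).continuous (mem_iInter.1 hx m)

theorem mem_residue_of_notMem {x : T} (hx : ∀ m : ℕ, x ∉ F^[m] '' L.line) : x ∈ L.residue F :=
  mem_iInter.2 fun m => subset_closure (hx m)

/-- An open arc of `T` contains at most one point of the residue. -/
theorem IsInfiniteGraph.subsingleton_residue_arc (hL : L.IsInfiniteGraph) (hF : L.IsDegreeOne F)
    (hdense : closure (⋃ n : ℕ, F^[n] '' L.line) = univ) {D : Set ℝ} (hDo : IsOpen D)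
    (hDc : D.OrdConnected) {γ : ℝ → T} (hγ : ContinuousOn γ D)
    (hopen : ∀ U ⊆ D, IsOpen U → IsOpen (γ '' U)) (hbdd : ∃ M, ∀ t ∈ D, L.r (γ t) ≤ M) :
    {t ∈ D | γ t ∈ L.residue F}.Subsingleton := by
  have key : ∀ a ∈ {t ∈ D | γ t ∈ L.residue F}, ∀ b ∈ {t ∈ D | γ t ∈ L.residue F}, ¬ a < b := by
    rintro a ⟨haD, haY⟩ b ⟨hbD, hbY⟩ hab
    have hsub : Ioo a b ⊆ D := Ioo_subset_Icc_self.trans (hDc.out haD hbD)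
    -- Some `F^m(ℝ)` meets the arc at `c` between `a` and `b`, yet misses points `γ a'` and `γ b'`
    -- on either side of `c`. The open subarc between them would then split off a part of the
    -- connected set `F^m(ℝ)`, which also contains line points with `r > M`, outside the arc.
    obtain ⟨_, ⟨c, hc, rfl⟩, hcX⟩ := (dense_iff_closure_eq.2 hdense).inter_open_nonempty _
      (hopen _ hsub isOpen_Ioo) ((nonempty_Ioo.2 hab).image γ)
    obtain ⟨m, hm⟩ := mem_iUnion.1 hcX
    obtain ⟨_, ⟨a', ⟨ha'D, ha'c⟩, rfl⟩, ha'⟩ := mem_closure_iff.1 (mem_iInter.1 haY m) _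
      (hopen (D ∩ Iio c) inter_subset_left (hDo.inter isOpen_Iio)) ⟨a, ⟨haD, hc.1⟩, rfl⟩
    obtain ⟨_, ⟨b', ⟨hb'D, hb'c⟩, rfl⟩, hb'⟩ := mem_closure_iff.1 (mem_iInter.1 hbY m) _
      (hopen (D ∩ Ioi c) inter_subset_left (hDo.inter isOpen_Ioi)) ⟨b, ⟨hbD, hc.2⟩, rfl⟩
    have hsub' : Icc a' b' ⊆ D := hDc.out ha'D hb'D
    have hZ : IsPreconnected (F^[m] '' L.line) :=
      isPreconnected_line.image _ (hF.1.iterate m).continuousOn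
    obtain ⟨M, hM⟩ := hbdd
    obtain ⟨x, -, ⟨t, ht, rfl⟩, hx2⟩ := hZ (γ '' Ioo a' b') (γ '' Icc a' b')ᶜ
      (hopen _ (Ioo_subset_Icc_self.trans hsub') isOpen_Ioo)
      (isCompact_Icc.image_of_continuousOn (hγ.mono hsub')).isClosed.isOpen_compl
      (fun x hx => by
        by_cases h : x ∈ γ '' Icc a' b'
        · obtain ⟨t, ht, rfl⟩ := h
          refine Or.inl ⟨t, ⟨lt_of_le_of_ne ht.1 ?_, lt_of_le_of_ne ht.2 ?_⟩, rfl⟩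
          · rintro rfl; exact ha' hx
          · rintro rfl; exact hb' hx
        · exact Or.inr h)
      ⟨γ c, hm, c, ⟨ha'c, hb'c⟩, rfl⟩
      ⟨L.h (M + 1), hL.line_subset_iterate_image_line hF m (L.h_mem_line _), by
        rintro ⟨t, ht, h⟩
        have := hM t (hsub' ht)
        rw [h, r_h] at this
        linarith⟩
    exact hx2 ⟨t, Ioo_subset_Icc_self ht, rfl⟩
  intro a ha b hb
  exact le_antisymm (not_lt.1 (key b hb a ha)) (not_lt.1 (key a ha b hb))

/-- If the complement of `V` in the fundamental slab has finitely many components, each of them is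
open up to the points `h 0` and `h 1`. -/
theorem IsInfiniteGraph.isOpen_component_diff (hL : L.IsInfiniteGraph) {V : Set T} (hV : V.Finite)
    (hfin : {C | IsComponentOf (L.r ⁻¹' Icc 0 1 \ V) C}.Finite) {E : Set T}
    (hE : IsComponentOf (L.r ⁻¹' Icc 0 1 \ V) E) : IsOpen (E \ {L.h 0, L.h 1}) := by
  obtain ⟨x, hx, rfl⟩ := hE
  set S := L.r ⁻¹' Icc 0 1 \ V with hS
  -- The slab is a neighbourhood of each of its points except possibly `h 0` and `h 1`. Removing `V`
  -- and the closures of the finitely many other components leaves an open set.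
  have h1 : IsOpen ((L.r ⁻¹' Ici 0 \ {L.h 0}) ∩ (L.r ⁻¹' Iic 1 \ {L.h 1})) :=
    (hL.isOpen_preimage_diff (by rw [Ici_sdiff_left]; exact isOpen_Ioi)).inter
      (hL.isOpen_preimage_diff (by rw [Iic_sdiff_right]; exact isOpen_Iio))
  have h2 : IsClosed (⋃ C ∈ {C | IsComponentOf S C} \ {connectedComponentIn S x}, closure C) :=
    (hfin.subset sdiff_subset).isClosed_biUnion fun _ _ => isClosed_closure
  have h3 : connectedComponentIn S x \ {L.h 0, L.h 1} =
      (((L.r ⁻¹' Ici 0 \ {L.h 0}) ∩ (L.r ⁻¹' Iic 1 \ {L.h 1})) \ V) \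
        ⋃ C ∈ {C | IsComponentOf S C} \ {connectedComponentIn S x}, closure C := by
    ext y
    constructor
    · rintro ⟨hy, hyn⟩
      have hyS := connectedComponentIn_subset S x hy
      rw [mem_insert_iff, mem_singleton_iff, not_or] at hyn
      refine ⟨⟨⟨⟨hyS.1.1, hyn.1⟩, hyS.1.2, hyn.2⟩, hyS.2⟩, ?_⟩
      simp only [mem_iUnion, not_exists]
      rintro _ ⟨⟨z, hz, rfl⟩, hne⟩ hyz
      apply hne
      have := closure_connectedComponentIn_inter_subset S z ⟨hyz, hyS⟩
      rw [mem_singleton_iff, connectedComponentIn_eq this, connectedComponentIn_eq hy]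
    · rintro ⟨⟨⟨⟨h0, h0'⟩, h1, h1'⟩, hyV⟩, hyn⟩
      have hyS : y ∈ S := ⟨⟨h0, h1⟩, hyV⟩
      refine ⟨?_, by rw [mem_insert_iff, mem_singleton_iff, not_or]; exact ⟨h0', h1'⟩⟩
      by_contra hy
      refine hyn (mem_biUnion (x := connectedComponentIn S y) ⟨⟨y, hyS, rfl⟩, fun h => hy ?_⟩
        (subset_closure (mem_connectedComponentIn hyS)))
      rw [mem_singleton_iff] at h
      rw [← h]
      exact mem_connectedComponentIn hyS
  rw [h3]
  exact (h1.sdiff hV.isClosed).sdiff h2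

/-- A finite set of cuts divides a real interval into finitely many open intervals. -/
theorem exists_cut_pieces {I P : Set ℝ} (hI : IsOpen I) (hIc : I.OrdConnected) (hP : P.Finite) :
    ∃ 𝒟 : Set (Set ℝ), 𝒟.Finite ∧ I \ P ⊆ ⋃₀ 𝒟 ∧
      ∀ D ∈ 𝒟, IsOpen D ∧ D.OrdConnected ∧ D ⊆ I \ P := by
  -- The piece lies above the cuts in `A` and below all others; it may be empty.
  let D : Set ℝ → Set ℝ := fun A => I ∩ ((⋂ p ∈ A, Ioi p) ∩ ⋂ p ∈ P \ A, Iio p)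
  refine ⟨D '' 𝒫 P, hP.finite_subsets.image D, ?_, ?_⟩
  · rintro t ⟨htI, htP⟩
    refine ⟨_, ⟨{p ∈ P | p < t}, fun p hp => hp.1, rfl⟩, htI, ?_, ?_⟩
    · exact mem_iInter₂.2 fun p hp => hp.2
    · refine mem_iInter₂.2 fun p hp => ?_
      have h1 : ¬ p < t := fun h => hp.2 ⟨hp.1, h⟩
      refine lt_of_le_of_ne (not_lt.1 h1) ?_
      rintro rfl
      exact htP hp.1
  · rintro _ ⟨A, hA, rfl⟩
    refine ⟨hI.inter (IsOpen.inter ((hP.subset hA).isOpen_biInter fun _ _ => isOpen_Ioi)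
      ((hP.subset sdiff_subset).isOpen_biInter fun _ _ => isOpen_Iio)), ?_, ?_⟩
    · refine hIc.inter (OrdConnected.inter ?_ ?_)
      · exact ordConnected_biInter fun _ _ => ordConnected_Ioi
      · exact ordConnected_biInter fun _ _ => ordConnected_Iio
    · rintro t ⟨htI, h1, h2⟩
      refine ⟨htI, fun htP => ?_⟩
      by_cases htA : t ∈ A
      · exact lt_irrefl t (mem_iInter₂.1 h1 t htA)
      · exact lt_irrefl t (mem_iInter₂.1 h2 t ⟨htP, htA⟩)

theorem IsInfiniteGraph.finite_residue_unit (hL : L.IsInfiniteGraph) (hF : L.IsDegreeOne F)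
    (hdense : closure (⋃ n : ℕ, F^[n] '' L.line) = univ) :
    (L.residue F ∩ L.r ⁻¹' Icc 0 1).Finite := by
  obtain ⟨-, -, V, -, hV, hfin, hint⟩ := id hL
  have hE : ∀ E, IsComponentOf (L.r ⁻¹' Icc 0 1 \ V) E → (L.residue F ∩ E).Finite := by
    intro E hE
    obtain ⟨e⟩ := hint E hE
    have hEopen := hL.isOpen_component_diff hV hfin hE
    have hES : E ⊆ L.r ⁻¹' Icc 0 1 := by
      obtain ⟨x, -, rfl⟩ := hE
      exact (connectedComponentIn_subset _ _).trans sdiff_subset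
    let γ : ℝ → T := fun t => if h : t ∈ Ioo (0 : ℝ) 1 then (e.symm ⟨t, h⟩ : T) else L.h 0
    have hγ : ∀ t : Ioo (0 : ℝ) 1, γ t = e.symm t := fun t => dif_pos t.2
    have hγE : ∀ t ∈ Ioo (0 : ℝ) 1, γ t ∈ E := fun t ht => by
      rw [hγ ⟨t, ht⟩]; exact (e.symm _).2
    have hγc : ContinuousOn γ (Ioo 0 1) := by
      rw [continuousOn_iff_continuous_domRestrict]
      exact (continuous_subtype_val.comp e.symm.continuous).congr fun t => (hγ t).symm
    have hγi : InjOn γ (Ioo 0 1) := by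
      intro s hs t ht hst
      rw [hγ ⟨s, hs⟩, hγ ⟨t, ht⟩] at hst
      simpa using e.symm.injective (Subtype.ext hst)
    -- The edge may fail to be open in `T` where it passes through `h 0` or `h 1`, so it is cut
    -- there.
    set P : Set ℝ := Ioo 0 1 ∩ γ ⁻¹' {L.h 0, L.h 1} with hP
    have hPfin : P.Finite :=
      Finite.of_finite_image (((finite_singleton (L.h 1)).insert (L.h 0)).subset
        (image_subset_iff.2 inter_subset_right)) (hγi.mono inter_subset_left)
    obtain ⟨𝒟, h𝒟, hcov, hD⟩ := exists_cut_pieces isOpen_Ioo ordConnected_Ioo hPfin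
    have hopen : ∀ U ⊆ Ioo 0 1 \ P, IsOpen U → IsOpen (γ '' U) := by
      intro U hU hUo
      have h1 : IsOpen (e.symm '' (Subtype.val ⁻¹' U)) :=
        e.symm.isOpenMap _ (hUo.preimage continuous_subtype_val)
      obtain ⟨O, hO, hOe⟩ := isOpen_induced_iff.1 h1
      have h2 : γ '' U = (E \ {L.h 0, L.h 1}) ∩ O := by
        ext x
        constructor
        · rintro ⟨t, ht, rfl⟩
          have h3 : e.symm ⟨t, (hU ht).1⟩ ∈ Subtype.val ⁻¹' O := by
            rw [hOe]; exact ⟨_, ht, rfl⟩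
          refine ⟨⟨hγE t (hU ht).1, fun h => (hU ht).2 ⟨(hU ht).1, h⟩⟩, ?_⟩
          rw [hγ ⟨t, (hU ht).1⟩]
          exact h3
        · rintro ⟨⟨hxE, -⟩, hxO⟩
          have h3 : (⟨x, hxE⟩ : E) ∈ e.symm '' (Subtype.val ⁻¹' U) := by
            rw [← hOe]; exact hxO
          obtain ⟨t, ht, h⟩ := h3
          exact ⟨t, ht, by rw [hγ, h]⟩
      rw [h2]
      exact hEopen.inter hO
    have hpiece : ∀ D ∈ 𝒟, {t ∈ D | γ t ∈ L.residue F}.Finite := fun D hDm =>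
      (hL.subsingleton_residue_arc hF hdense (hD D hDm).1 (hD D hDm).2.1
        (hγc.mono ((hD D hDm).2.2.trans sdiff_subset))
        (fun U hU => hopen U (hU.trans (hD D hDm).2.2))
        ⟨1, fun t ht => (hES (hγE t ((hD D hDm).2.2 ht).1)).2⟩).finite
    refine ((hPfin.union (h𝒟.biUnion hpiece)).image γ).subset ?_
    rintro x ⟨hxY, hxE⟩
    have hγx : γ (e ⟨x, hxE⟩) = x := by rw [hγ]; simp
    refine ⟨e ⟨x, hxE⟩, ?_, hγx⟩
    by_cases h : (e ⟨x, hxE⟩ : ℝ) ∈ P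
    · exact Or.inl h
    · obtain ⟨D, hDm, hxD⟩ := hcov ⟨(e ⟨x, hxE⟩).2, h⟩
      exact Or.inr (mem_biUnion hDm ⟨hxD, by rwa [hγx]⟩)
  refine (hV.union (hfin.biUnion hE)).subset ?_
  rintro x ⟨hxY, hx⟩
  by_cases hxV : x ∈ V
  · exact Or.inl hxV
  · exact Or.inr (mem_biUnion (x := connectedComponentIn _ x) ⟨x, ⟨hx, hxV⟩, rfl⟩
      ⟨hxY, mem_connectedComponentIn ⟨hx, hxV⟩⟩)

theorem IsInfiniteGraph.finite_residue_inter (hL : L.IsInfiniteGraph) (hF : L.IsDegreeOne F)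
    (hdense : closure (⋃ n : ℕ, F^[n] '' L.line) = univ) (a b : ℝ) :
    (L.residue F ∩ L.r ⁻¹' Icc a b).Finite := by
  refine ((finite_Icc ⌊a⌋ ⌊b⌋).biUnion fun n _ =>
    (hL.finite_residue_unit hF hdense).image (L.τ ^ n)).subset ?_
  rintro x ⟨hxY, hx⟩
  refine mem_biUnion (x := ⌊L.r x⌋) ⟨Int.floor_mono hx.1, Int.floor_mono hx.2⟩
    ⟨(L.τ ^ (-⌊L.r x⌋)) x, ⟨hF.τ_zpow_mem_residue _ hxY, ?_⟩, L.τ_zpow_cancel _ _⟩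
  simp only [mem_preimage, mem_Icc, r_τ_zpow]
  push_cast
  have := Int.floor_le (L.r x)
  have := Int.lt_floor_add_one (L.r x)
  constructor <;> linarith

end LiftedSpace

/-! ### Shadowing arbitrary orbits by orbits of the line -/

namespace LiftedSpace

variable {T : Type*} [MetricSpace T] {L : LiftedSpace T} {F : T → T}

theorem IsInfiniteGraph.exists_translate_eq_of_residue (hL : L.IsInfiniteGraph)
    (hF : L.IsDegreeOne F) (hdense : closure (⋃ n : ℕ, F^[n] '' L.line) = univ) {v : ℕ → T}
    (hv : ∀ j, v j ∈ L.residue F) : ∃ i j : ℕ, i < j ∧ ∃ c : ℤ, v j = (L.τ ^ c) (v i) := by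
  obtain ⟨i, j, hij, h⟩ := (hL.finite_residue_unit hF hdense).exists_lt_map_eq_of_forall_mem
    (f := fun j => (L.τ ^ (-⌊L.r (v j)⌋)) (v j)) fun j => by
      refine ⟨hF.τ_zpow_mem_residue _ (hv j), ?_⟩
      simp only [mem_preimage, mem_Icc, r_τ_zpow]
      push_cast
      have := Int.floor_le (L.r (v j))
      have := Int.lt_floor_add_one (L.r (v j))
      constructor <;> linarith
  refine ⟨i, j, hij, ⌊L.r (v j)⌋ - ⌊L.r (v i)⌋, ?_⟩
  rw [sub_eq_add_neg, zpow_add, Homeomorph.mul_apply]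
  exact (L.τ_zpow_cancel _ (v j)).symm.trans (congrArg _ h.symm)

/-- Near a fixed point `z` outside all the images of the line, the backward orbit along which a
point is first reached from the line stays near `z`. -/
theorem IsInfiniteGraph.exists_backward_stable (hL : L.IsInfiniteGraph) (hF : L.IsDegreeOne F)
    (hdense : closure (⋃ n : ℕ, F^[n] '' L.line) = univ) {z : T} (hz : F z = z) {B : Set T}
    (hBz : B ∈ 𝓝 z) (hBc : IsClosed B) (hBr : B ⊆ L.r ⁻¹' Icc (L.r z - 1) (L.r z + 1))
    (hBY : L.residue F ∩ B ⊆ {z}) :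
    ∃ m₀ : ℕ, ∀ n ≥ m₀, ∀ w ∈ L.line, F^[n + 1] w ∈ B → F^[n + 1] w ∉ F^[n] '' L.line →
      F^[n] w ∈ B := by
  by_contra! hcon
  choose n hn w hw h1 h2 h3 using hcon
  obtain ⟨C, hC0, hC⟩ := hL.exists_displacement_bound hF
  set p : ℕ → ℕ → T := fun j k => F^[n k + 1 - j] (w k) with hp
  have hpF : ∀ i j k, i ≤ j → j ≤ k → F^[i] (p j k) = p (j - i) k := by
    intro i j k hij hjk
    have := hn k
    rw [hp]
    simp only
    rw [← Function.iterate_add_apply]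
    congr 1
    omega
  have hev : ∀ j, ∀ᶠ k in (hyperfilter ℕ : Filter ℕ), j ≤ k := fun j =>
    (Nat.hyperfilter_le_atTop (eventually_ge_atTop j))
  -- One ultrafilter gives limits for all `j` at once, so the limits form a backward orbit `v` of `v
  -- 0`.
  have hlim : ∀ j, ∃ v, Tendsto (p j) (hyperfilter ℕ) (𝓝 v) := by
    intro j
    obtain ⟨v, -, hv⟩ := (hL.isCompact_preimage_Icc (L.r z - 1 - j * C)
      (L.r z + 1 + j * C)).ultrafilter_le_nhds ((hyperfilter ℕ).map (p j)) (by
        rw [le_principal_iff, Ultrafilter.mem_coe, Ultrafilter.mem_map, ← Ultrafilter.mem_coe]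
        filter_upwards [hev j] with k hk
        have h4 := abs_le.1 (abs_r_iterate_sub_le hC j (p j k))
        rw [hpF j j k le_rfl hk, Nat.sub_self] at h4
        have h5 : p 0 k ∈ L.r ⁻¹' Icc (L.r z - 1) (L.r z + 1) := hBr (h1 k)
        exact ⟨by linarith [h5.1, h4.2], by linarith [h5.2, h4.1]⟩)
    exact ⟨v, hv⟩
  choose v hv using hlim
  have hvF : ∀ i j, i ≤ j → F^[i] (v j) = v (j - i) := by
    intro i j hij
    refine tendsto_nhds_unique (((hF.1.iterate i).tendsto (v j)).comp (hv j)) ?_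
    refine (hv (j - i)).congr' ?_
    filter_upwards [hev j] with k hk
    exact (hpF i j k hij hk).symm
  -- If `p j k` lay in `F^m(ℝ)` with `m + j ≤ n k`, then `p 0 k` would lie in `F^(n k)(ℝ)`, which is
  -- excluded.
  have hvY : ∀ j, v j ∈ L.residue F := by
    intro j
    refine mem_iInter.2 fun m => mem_closure_of_tendsto (hv j) ?_
    filter_upwards [hev (j + m)] with k hk hmem
    have hnk := hn k
    obtain ⟨y, hy, hyp⟩ := hL.monotone_image_line hF (show m ≤ n k - j by omega) hmem
    refine h2 k ⟨y, hy, ?_⟩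
    have h4 := hpF j j k le_rfl (by omega)
    rw [← hyp, ← Function.iterate_add_apply, Nat.sub_self, Nat.add_sub_cancel' (by omega)] at h4
    exact h4
  have hv0 : v 0 = z := hBY ⟨hvY 0, hBc.mem_of_tendsto (hv 0) (Eventually.of_forall h1)⟩
  -- A repetition mod 1 in the backward orbit, pushed forward `j - 1` times, gives `v 1 = z + c`. As
  -- `F (v 1) = z`, this forces `z + c = z`, so `F^[n k] (w k)` enters `B`.
  obtain ⟨i, j, hij, c, hc⟩ := hL.exists_translate_eq_of_residue hF hdense hvY
  have h4 : v 1 = (L.τ ^ c) z := by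
    have h5 := hvF (j - 1) j (by omega)
    rw [show j - (j - 1) = 1 by omega, hc, (hF.iterate _).apply_τ_zpow,
      show j - 1 = (j - 1 - i) + i by omega, Function.iterate_add_apply, hvF i i le_rfl,
      Nat.sub_self, hv0, Function.iterate_fixed hz] at h5
    exact h5.symm
  have h5 : v 1 = z := by
    have h6 := hvF 1 1 le_rfl
    rw [Nat.sub_self, hv0, Function.iterate_one, h4, hF.apply_τ_zpow, hz] at h6
    rw [h4, h6]
  have h6 := hv 1
  rw [h5] at h6
  obtain ⟨k, hk⟩ := (h6.eventually hBz).exists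
  exact h3 k hk

/-- For each `k`, a point near `z` outside `F^k(ℝ)` is first reached from the line after more than
`k` steps. Backward stability keeps that orbit near `z` from time `m₀` on; the starting points are
bounded and accumulate at the required one. -/
theorem IsInfiniteGraph.exists_line_of_fixed (hL : L.IsInfiniteGraph) (hF : L.IsDegreeOne F)
    (hdense : closure (⋃ n : ℕ, F^[n] '' L.line) = univ) {z : T} (hz : F z = z)
    (hzX : ∀ m : ℕ, z ∉ F^[m] '' L.line) :
    ∃ w A, ∀ i : ℕ, |L.r (F^[i] (L.h w)) - L.r z| ≤ A := by
  obtain ⟨C, hC0, hC⟩ := hL.exists_displacement_bound hF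
  have hnhds : L.r ⁻¹' Ioo (L.r z - 1) (L.r z + 1) ∩
      ((L.residue F ∩ L.r ⁻¹' Icc (L.r z - 1) (L.r z + 1)) \ {z})ᶜ ∈ 𝓝 z := by
    refine inter_mem (hL.continuous_r.continuousAt (Ioo_mem_nhds (by linarith) (by linarith))) ?_
    exact ((hL.finite_residue_inter hF hdense _ _).subset
      sdiff_subset).isClosed.isOpen_compl.mem_nhds fun h => h.2 rfl
  obtain ⟨ε, hε, hB⟩ := Metric.nhds_basis_closedBall.mem_iff.1 hnhds
  set B := Metric.closedBall z ε
  have hBr : B ⊆ L.r ⁻¹' Icc (L.r z - 1) (L.r z + 1) := fun x hx =>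
    Ioo_subset_Icc_self (hB hx).1
  have hBc : IsClosed B := Metric.isClosed_closedBall
  obtain ⟨m₀, hm₀⟩ := hL.exists_backward_stable hF hdense hz (Metric.closedBall_mem_nhds z hε)
    hBc hBr (fun x hx => by
      by_contra h
      exact (hB hx.2).2 ⟨⟨hx.1, hBr hx.2⟩, h⟩)
  have hseq : ∀ k : ℕ, ∃ s : ℝ, ∀ i, m₀ ≤ i → i ≤ k → F^[i] (L.h s) ∈ B := by
    intro k
    obtain ⟨x, ⟨hxB, hxk⟩, hxX⟩ := (dense_iff_closure_eq.2 hdense).inter_open_nonempty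
      (Metric.ball z ε ∩ (F^[k] '' L.line)ᶜ)
      (Metric.isOpen_ball.inter (hL.isClosed_image_line (hF.iterate k)).isOpen_compl)
      ⟨z, Metric.mem_ball_self hε, hzX k⟩
    classical
    have hex : ∃ n, x ∈ F^[n] '' L.line := mem_iUnion.1 hxX
    obtain ⟨_, ⟨s, rfl⟩, hs⟩ := Nat.find_spec hex
    have hmin := fun m => Nat.find_min (m := m) hex
    set n := Nat.find hex
    have hkn : k < n := by
      by_contra h
      exact hxk (hL.monotone_image_line hF (not_lt.1 h) (Nat.find_spec hex))
    have hdesc : ∀ d, m₀ + d ≤ n → F^[n - d] (L.h s) ∈ B := by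
      intro d
      induction d with
      | zero =>
        intro _
        rw [Nat.sub_zero, hs]
        exact Metric.ball_subset_closedBall hxB
      | succ d ih =>
        intro hd
        have h1 := ih (by omega)
        rw [show n - d = n - (d + 1) + 1 by omega] at h1
        refine hm₀ _ (by omega) _ (L.h_mem_line s) h1 ?_
        -- Otherwise applying `F^[d]` would put `x` in `F^(n-1)(ℝ)`, against the minimality of `n`.
        rintro ⟨y, hy, hyx⟩
        refine hmin (n - 1) (by omega) ⟨y, hy, ?_⟩
        have h2 := congrArg F^[d] hyx
        rw [← Function.iterate_add_apply, ← Function.iterate_add_apply,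
          show d + (n - (d + 1) + 1) = n by omega, hs,
          show d + (n - (d + 1)) = n - 1 by omega] at h2
        exact h2
    refine ⟨s, fun i h1 h2 => ?_⟩
    have := hdesc (n - i) (by omega)
    rwa [show n - (n - i) = i by omega] at this
  choose s hs using hseq
  have hev : ∀ j, ∀ᶠ k in (hyperfilter ℕ : Filter ℕ), j ≤ k := fun j =>
    (Nat.hyperfilter_le_atTop (eventually_ge_atTop j))
  obtain ⟨u, -, hu⟩ := (isCompact_Icc (a := L.r z - 1 - m₀ * C)
    (b := L.r z + 1 + m₀ * C)).ultrafilter_le_nhds ((hyperfilter ℕ).map s) (by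
      rw [le_principal_iff, Ultrafilter.mem_coe, Ultrafilter.mem_map, ← Ultrafilter.mem_coe]
      filter_upwards [hev m₀] with k hk
      have h4 := abs_le.1 (abs_r_iterate_sub_le hC m₀ (L.h (s k)))
      have h5 := hBr (hs k m₀ le_rfl hk)
      rw [r_h] at h4
      exact ⟨by linarith [h5.1, h4.2], by linarith [h5.2, h4.1]⟩)
  have huB : ∀ i, m₀ ≤ i → F^[i] (L.h u) ∈ B := by
    intro i hi
    refine hBc.mem_of_tendsto ((((hF.1.iterate i).comp L.isEmbedding_h.continuous).tendsto u).comp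
      (show Tendsto s (hyperfilter ℕ) (𝓝 u) from hu)) ?_
    filter_upwards [hev i] with k hk
    exact hs k i hi hk
  refine ⟨u, 1 + m₀ * C, fun i => ?_⟩
  have h1 : ∀ i, m₀ ≤ i → |L.r (F^[i] (L.h u)) - L.r z| ≤ 1 := by
    intro i hi
    have := hBr (huB i hi)
    rw [abs_le]
    constructor <;> linarith [this.1, this.2]
  have h2 := abs_r_iterate_sub_le hC m₀ (F^[i] (L.h u))
  rw [← Function.iterate_add_apply] at h2
  have h3 := h1 (m₀ + i) (by omega)
  have h4 := abs_sub_le (L.r (F^[i] (L.h u))) (L.r (F^[m₀ + i] (L.h u))) (L.r z)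
  rw [abs_sub_comm] at h2
  linarith

theorem IsDegreeOne.translate (hF : L.IsDegreeOne F) (c : ℤ) :
    L.IsDegreeOne fun x => (L.τ ^ c) (F x) := by
  refine ⟨(L.τ ^ c).continuous.comp hF.1, fun x => ?_⟩
  change (L.τ ^ c) (F (L.τ x)) = L.τ ((L.τ ^ c) (F x))
  rw [hF.2, ← Homeomorph.mul_apply, ← Homeomorph.mul_apply, ← zpow_add_one, ← zpow_one_add,
    add_comm]

theorem IsDegreeOne.translate_iterate (hF : L.IsDegreeOne F) (c : ℤ) (m : ℕ) (x : T) :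
    (fun x => (L.τ ^ c) (F x))^[m] x = (L.τ ^ (m * c)) (F^[m] x) := by
  induction m with
  | zero => simp
  | succ m ih =>
    rw [Function.iterate_succ_apply', ih, hF.apply_τ_zpow, Function.iterate_succ_apply',
      ← Homeomorph.mul_apply, ← zpow_add]
    congr 3
    push_cast; ring

theorem IsDegreeOne.translate_iterate_image_line (hF : L.IsDegreeOne F) (c : ℤ) (m : ℕ) :
    (fun x => (L.τ ^ c) (F x))^[m] '' L.line = F^[m] '' L.line := by
  ext x
  constructor
  · rintro ⟨y, hy, rfl⟩
    rw [hF.translate_iterate]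
    exact (hF.iterate m).τ_zpow_mem_image_line _ (mem_image_of_mem _ hy)
  · intro hx
    obtain ⟨y, hy, h⟩ := (hF.iterate m).τ_zpow_mem_image_line (-(m * c)) hx
    refine ⟨y, hy, ?_⟩
    rw [hF.translate_iterate, h, τ_zpow_cancel]

/-- If the images of the line are dense, then every orbit stays at a bounded distance from the orbit
of a point of the line. -/
theorem IsInfiniteGraph.exists_line_shadow (hL : L.IsInfiniteGraph) (hF : L.IsDegreeOne F)
    (hdense : closure (⋃ n : ℕ, F^[n] '' L.line) = univ) (y : T) :
    ∃ w A, ∀ n : ℕ, |L.r (F^[n] y) - L.r (F^[n] (L.h w))| ≤ A := by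
  obtain ⟨C, hC0, hC⟩ := hL.exists_displacement_bound hF
  have hshift : ∀ (m n : ℕ) (x : T), |L.r (F^[n] (F^[m] x)) - L.r (F^[n] x)| ≤ m * C := by
    intro m n x
    have := abs_r_iterate_sub_le hC m (F^[n] x)
    rwa [← Function.iterate_add_apply, add_comm, Function.iterate_add_apply] at this
  by_cases hy : ∃ a m : ℕ, F^[a] y ∈ F^[m] '' L.line
  · obtain ⟨a, m, _, ⟨w, rfl⟩, hw⟩ := hy
    refine ⟨w, a * C + m * C, fun n => ?_⟩
    have h1 := hshift a n y
    have h2 := hshift m n (L.h w)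
    rw [hw] at h2
    rw [abs_sub_comm] at h1
    exact (abs_sub_le _ _ _).trans (add_le_add h1 h2)
  · push Not at hy
    obtain ⟨i, j, hij, c, hc⟩ := hL.exists_translate_eq_of_residue hF hdense
      fun a => mem_residue_of_notMem (hy a)
    obtain ⟨q, rfl⟩ := Nat.exists_eq_add_of_lt hij
    set z := F^[i] y with hz
    have hqz : F^[q + 1] z = (L.τ ^ c) z := by
      rw [← hc, hz, ← Function.iterate_add_apply]
      congr 1
      omega
    have hFq := hF.iterate (q + 1)
    -- `G` fixes `z`, and its images of the line are those of `F` at multiples of `q + 1`, whose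
    -- union is still dense by monotonicity.
    set G : T → T := fun x => (L.τ ^ (-c)) (F^[q + 1] x) with hG
    have hGd : L.IsDegreeOne G := hFq.translate (-c)
    have hGi : ∀ m : ℕ, G^[m] '' L.line = F^[(q + 1) * m] '' L.line := fun m => by
      rw [Function.iterate_mul, hG, hFq.translate_iterate_image_line]
    have hGz : G z = z := by
      rw [hG]
      simp only
      rw [hqz, τ_zpow_cancel']
    have hGdense : closure (⋃ n : ℕ, G^[n] '' L.line) = univ := by
      refine univ_subset_iff.1 (hdense ▸ closure_mono (iUnion_mono fun n => ?_))
      rw [hGi]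
      exact hL.monotone_image_line hF (Nat.le_mul_of_pos_left n (by omega))
    obtain ⟨w, A, hw⟩ := hL.exists_line_of_fixed hGd hGdense hGz fun m => by
      rw [hGi]; exact hy i _
    refine ⟨w, i * C + ((q + 1) * C + A + (q + 1) * C), fun n => ?_⟩
    have h1 := hshift i n y
    rw [abs_sub_comm] at h1
    refine (abs_sub_le _ _ _).trans (add_le_add h1 ?_)
    rw [← hz]
    set m := n / (q + 1)
    set s := n % (q + 1)
    have hn : n = s + (q + 1) * m := (Nat.mod_add_div n (q + 1)).symm
    have hs : (s : ℝ) * C ≤ (q + 1) * C := by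
      gcongr
      exact_mod_cast (Nat.mod_lt n (by omega)).le
    have hr : ∀ x, L.r (F^[(q + 1) * m] x) = L.r (G^[m] x) + m * c := by
      intro x
      rw [hG, hFq.translate_iterate, r_τ_zpow, Function.iterate_mul]
      push_cast; ring
    have h2 := abs_r_iterate_sub_le hC s (F^[(q + 1) * m] z)
    have h3 := abs_r_iterate_sub_le hC s (F^[(q + 1) * m] (L.h w))
    rw [← Function.iterate_add_apply, ← hn, hr] at h2 h3
    rw [Function.iterate_fixed hGz] at h2
    have h4 := hw m
    rw [abs_le] at h2 h3 h4 ⊢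
    constructor <;> linarith [h2.1, h2.2, h3.1, h3.2, h4.1, h4.2]

end LiftedSpace

/-! ### Limits of averages, transitivity and the theorem -/

theorem tendsto_div_of_abs_sub_le {a : ℕ → ℝ} {α : ℝ}
    (h : ∀ ε > 0, ∃ C, ∀ n : ℕ, |a n - n * α| ≤ C + ε * n) :
    Tendsto (fun n : ℕ => a n / n) atTop (𝓝 α) := by
  rw [Metric.tendsto_atTop]
  intro ε hε
  obtain ⟨C, hC⟩ := h (ε / 2) (by positivity)
  obtain ⟨N, hN⟩ := exists_nat_gt (C / (ε / 2))
  refine ⟨max N 1, fun n hn => ?_⟩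
  have hn0 : (0 : ℝ) < n := by exact_mod_cast (le_max_right N 1).trans hn
  have hnN : (N : ℝ) ≤ n := by exact_mod_cast (le_max_left N 1).trans hn
  rw [div_lt_iff₀ (by positivity)] at hN
  have h1 : a n / n - α = (a n - n * α) / n := by field_simp
  rw [Real.dist_eq, h1, abs_div, abs_of_pos hn0, div_lt_iff₀ hn0]
  have := hC n
  nlinarith

namespace LiftedSpace

variable {T : Type*} [MetricSpace T] {L : LiftedSpace T} {F : T → T}

theorem abs_average_le {C : ℝ} (hC : ∀ x, |L.r (F x) - L.r x| ≤ C) (x : T) (n : ℕ) :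
    |(L.r (F^[n] x) - L.r x) / n| ≤ C := by
  have hC0 : 0 ≤ C := (abs_nonneg _).trans (hC x)
  rw [abs_div, Nat.abs_cast]
  exact div_le_of_le_mul₀ (by positivity) hC0 (by
    rw [mul_comm]; exact abs_r_iterate_sub_le hC n x)

theorem IsInfiniteGraph.isBounded_average (hL : L.IsInfiniteGraph) (hF : L.IsDegreeOne F) (x : T) :
    IsBoundedUnder (· ≤ ·) atTop (fun n : ℕ => (L.r (F^[n] x) - L.r x) / n) ∧
      IsBoundedUnder (· ≥ ·) atTop (fun n : ℕ => (L.r (F^[n] x) - L.r x) / n) := by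
  obtain ⟨C, -, hC⟩ := hL.exists_displacement_bound hF
  exact ⟨isBoundedUnder_of ⟨C, fun n => (abs_le.1 (abs_average_le hC x n)).2⟩,
    isBoundedUnder_of ⟨-C, fun n => (abs_le.1 (abs_average_le hC x n)).1⟩⟩

theorem IsInfiniteGraph.frequently_near_upperRot (hL : L.IsInfiniteGraph) (hF : L.IsDegreeOne F)
    (x : T) {ε : ℝ} (hε : 0 < ε) :
    ∃ᶠ n : ℕ in atTop, |(L.r (F^[n] x) - L.r x) / n - L.upperRot F x| < ε := by
  obtain ⟨h1, h2⟩ := hL.isBounded_average hF x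
  have h3 := frequently_lt_of_lt_limsup h2.isCoboundedUnder_le
    (show L.upperRot F x - ε < L.upperRot F x by linarith)
  have h4 := eventually_lt_of_limsup_lt (show L.upperRot F x < L.upperRot F x + ε by linarith) h1
  refine (h3.and_eventually h4).mono fun n hn => ?_
  rw [abs_lt]
  constructor <;> linarith [hn.1, hn.2]

theorem IsInfiniteGraph.frequently_near_lowerRot (hL : L.IsInfiniteGraph) (hF : L.IsDegreeOne F)
    (x : T) {ε : ℝ} (hε : 0 < ε) :
    ∃ᶠ n : ℕ in atTop, |(L.r (F^[n] x) - L.r x) / n - L.lowerRot F x| < ε := by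
  obtain ⟨h1, h2⟩ := hL.isBounded_average hF x
  have h3 := frequently_lt_of_liminf_lt h1.isCoboundedUnder_ge
    (show L.lowerRot F x < L.lowerRot F x + ε by linarith)
  have h4 := eventually_lt_of_lt_liminf (show L.lowerRot F x - ε < L.lowerRot F x by linarith) h2
  refine (h3.and_eventually h4).mono fun n hn => ?_
  rw [abs_lt]
  constructor <;> linarith [hn.1, hn.2]

/-- Shadowing transfers the limit point `α` to an orbit from the line, since bounded errors vanish
on average; `exists_rotation` then makes it a true limit. -/
theorem IsInfiniteGraph.mem_rotLine_of_frequently (hL : L.IsInfiniteGraph) (hF : L.IsDegreeOne F)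
    (hdense : closure (⋃ n : ℕ, F^[n] '' L.line) = univ) {x : T} {α : ℝ}
    (hα : ∀ ε > 0, ∃ᶠ n : ℕ in atTop, |(L.r (F^[n] x) - L.r x) / n - α| < ε) :
    α ∈ L.RotLine F := by
  obtain ⟨w, A, hA⟩ := hL.exists_line_shadow hF hdense x
  obtain ⟨u, hu⟩ := hL.exists_rotation hF (w := w) (α := α) (fun ε hε N => by
    obtain ⟨M, hM⟩ := exists_nat_gt (2 * A / (ε / 2))
    obtain ⟨n, hn, hnα⟩ := (frequently_atTop.1 (hα (ε / 2) (by positivity))) (max N (max M 1))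
    have hnN : N ≤ n := (le_max_left _ _).trans hn
    have hnM : (M : ℝ) ≤ n := by
      exact_mod_cast ((le_max_left M 1).trans (le_max_right _ _)).trans hn
    have hn0 : (0 : ℝ) < n := by
      exact_mod_cast ((le_max_right M 1).trans (le_max_right N _)).trans hn
    refine ⟨n, hnN, ?_⟩
    rw [div_lt_iff₀ (by positivity)] at hM
    have h1 : (L.r (F^[n] x) - L.r x) / n - α = (L.r (F^[n] x) - L.r x - n * α) / n := by
      field_simp
    rw [h1, abs_div, abs_of_pos hn0, div_lt_iff₀ hn0] at hnα
    have h2 := abs_le.1 (hA n)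
    have h3 := abs_le.1 (hA 0)
    have h4 := abs_lt.1 hnα
    rw [Function.iterate_zero_apply, Function.iterate_zero_apply, r_h] at h3
    have h5 : 2 * A ≤ ε / 2 * n := by nlinarith
    rw [abs_le]
    constructor <;> linarith [h2.1, h2.2, h3.1, h3.2, h4.1, h4.2])
  have hlim : Tendsto (fun n : ℕ => (L.r (F^[n] (L.h u)) - L.r (L.h u)) / n) atTop (𝓝 α) :=
    tendsto_div_of_abs_sub_le (by simpa using hu)
  exact ⟨L.h u, L.h_mem_line u, hlim.liminf_eq, hlim.limsup_eq⟩

theorem IsInfiniteGraph.exists_open_subset_line (hL : L.IsInfiniteGraph) :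
    ∃ U ⊆ L.line, IsOpen U ∧ U.Nonempty := by
  have hfin := L.finite_feet_inter_unit
  refine ⟨L.r ⁻¹' (Ioo 0 1 \ (L.feet ∩ Icc 0 1)), fun x hx => ?_,
    (isOpen_Ioo.sdiff hfin.isClosed).preimage hL.continuous_r, ?_⟩
  · by_contra h
    exact hx.2 ⟨⟨x, h, rfl⟩, Ioo_subset_Icc_self hx.1⟩
  · obtain ⟨t, ht⟩ := ((Ioo_infinite (zero_lt_one' ℝ)).sdiff hfin).nonempty
    exact ⟨L.h t, by rwa [mem_preimage, r_h]⟩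

/-- The line contains a nonempty open set of `T`, obtained by avoiding the feet. Its iterates reach
every open set mod 1, and the images of the line are invariant under translation. -/
theorem IsInfiniteGraph.dense_of_isTransitiveModOne (hL : L.IsInfiniteGraph)
    (hF : L.IsDegreeOne F) (htr : L.IsTransitiveModOne F) :
    closure (⋃ n : ℕ, F^[n] '' L.line) = univ := by
  obtain ⟨U, hUl, hUo, hUn⟩ := hL.exists_open_subset_line
  rw [← dense_iff_closure_eq, dense_iff_inter_open]
  intro V hVo hVn
  obtain ⟨n, x, hx, hxV⟩ := htr U V hUo hUn hVo hVn
  obtain ⟨m, y, hy, rfl⟩ := mem_iUnion.1 hx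
  exact ⟨_, hxV, mem_iUnion.2 ⟨n, (hF.iterate n).τ_zpow_mem_image_line m (image_mono hUl hy)⟩⟩

end LiftedSpace

theorem mainTheorem6 {T : Type*} [MetricSpace T] [ConnectedSpace T] (L : LiftedSpace T)
    (hL : L.IsInfiniteGraph) (F : T → T) (hF : L.IsDegreeOne F) :
    (closure (⋃ n : ℕ, F^[n] '' L.line) = Set.univ →
      L.RotLine F = L.Rot F ∧ L.Rot F = L.RotPlus F ∧ L.RotPlus F = L.RotMinus F) ∧
    (L.IsTransitiveModOne F → closure (⋃ n : ℕ, F^[n] '' L.line) = Set.univ) := by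
  refine ⟨fun hdense => ?_, hL.dense_of_isTransitiveModOne hF⟩
  have h1 : L.RotLine F ⊆ L.Rot F := fun ρ ⟨x, _, hx⟩ => ⟨x, hx⟩
  have h2 : L.Rot F ⊆ L.RotPlus F := fun ρ ⟨x, hx⟩ => ⟨x, hx.2⟩
  have h3 : L.Rot F ⊆ L.RotMinus F := fun ρ ⟨x, hx⟩ => ⟨x, hx.1⟩
  have h4 : L.RotPlus F ⊆ L.RotLine F := by
    rintro _ ⟨x, rfl⟩
    exact hL.mem_rotLine_of_frequently hF hdense fun ε hε => hL.frequently_near_upperRot hF x hε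
  have h5 : L.RotMinus F ⊆ L.RotLine F := by
    rintro _ ⟨x, rfl⟩
    exact hL.mem_rotLine_of_frequently hF hdense fun ε hε => hL.frequently_near_lowerRot hF x hε
  exact ⟨h1.antisymm (h2.trans h4), h2.antisymm (h4.trans h1),
    (h4.trans (h1.trans h3)).antisymm (h5.trans (h1.trans h2))⟩
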